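/- Let $\alpha\in\mathbb R$, let $\mathbb D$ be the open unit disc in $\mathbb C$ and $\mathbb T=\partial\mathbb D$. Definitions. A function $u$ on $\mathbb D$ is \emph{$\alpha$-harmonic} if $u\in C^2(\mathbb D)$ and $\partial_z\big((1-|z|^2)^{-\alpha}\,\bar\partial_z u\big)=0$ in $\mathbb D$. It has \emph{temperate growth} if there are constants $C,N>0$ such that $|u(z)|\le C(1-|z|^2)^{-N}$ for all $z\in\mathbb D$. An $\alpha$-harmonic function $u$ has a unique expansion $$u(z)=\sum_{k=0}^\infty c_k z^k+\sum_{k=1}^\infty c_{-k}\,F(-\alpha,k;k+1;|z|^2)\,\bar z^k,\qquad z\in\mathbb D,$$ with $c_k\in\mathbb C$ and $\limsup_{|k|\to\infty}|c_k|^{1/|k|}\le 1$, where $F$ is the Gauss hypergeometric function; its \emph{spectrum} is $\operatorname{Spec}(u)=\{k\in\mathbb Z: c_k\ne0\}$. The $\alpha$-harmonic \emph{Poisson kernel} is $$P_\alpha(z)=\frac{(1-|z|^2)^{\alpha+1}}{(1-z)(1-\bar z)^{\alpha+1}},\qquad z\in\mathbb D$$ (principal branch), which is itself $\alpha$-harmonic.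 The \emph{Poisson integral} of a distribution $f\in\mathscr D'(\mathbb T)$ is the function $$P_\alpha[f](z)=(P_{\alpha,r}*f)(e^{i\theta})=\big\langle f,\ e^{i\tau}\mapsto P_\alpha(ze^{-i\tau})\big\rangle,\qquad z=re^{i\theta}\in\mathbb D,$$ where $P_{\alpha,r}(e^{i\theta})=P_\alpha(re^{i\theta})$. Theorem. Let $u$ be a complex-valued function on $\mathbb D$. (1) There is an $f\in\mathscr D'(\mathbb T)$ with $u=P_\alpha[f]$ in $\mathbb D$ if and only if $u$ is $\alpha$-harmonic in $\mathbb D$, $u$ has temperate growth in $\mathbb D$, and $\operatorname{Spec}(u)\subset\operatorname{Spec}(P_\alpha)$. (2) Suppose that $\alpha$ is not a negative integer. Then $\operatorname{Spec}(u)\subset\operatorname{Spec}(P_\alpha)$ holds for every $\alpha$-harmonic function $u$ in $\mathbb D$. Consequently, there is an $f\in\mathscr D'(\mathbb T)$ with $u=P_\alpha[f]$ in $\mathbb D$ if and only if $u$ is $\alpha$-harmonic in $\mathbb D$ and has temperate growth in $\mathbb D$. -/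

import Mathlib

open scoped ContDiff ComplexConjugate

noncomputable section

namespace AlphaHarmonic

/-! ### Test functions and distributions on the unit circle -/

/-- The complex vector space of functions on the unit circle that are smooth, i.e. that are
infinitely differentiable functions of the angle. -/
def smoothCircle : Submodule ℂ (Circle → ℂ) where
  carrier := {φ | ContDiff ℝ ∞ (fun θ : ℝ => φ (Circle.exp θ))}
  add_mem' {φ ψ} hφ hψ := by
    simp only [Set.mem_ofPred_eq] at hφ hψ ⊢
    exact hφ.add hψ
  zero_mem' := by
    simp only [Set.mem_ofPred_eq]
    exact contDiff_const
  smul_mem' c φ hφ := by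
    simp only [Set.mem_ofPred_eq] at hφ ⊢
    exact hφ.const_smul c

/-- The space `C^∞(𝕋)` of test functions on the unit circle. (A type of its own, so that it does
not inherit the topology of pointwise convergence.) -/
def TestFunction : Type := smoothCircle

namespace TestFunction

instance : AddCommGroup TestFunction := inferInstanceAs (AddCommGroup smoothCircle)

instance : Module ℂ TestFunction := inferInstanceAs (Module ℂ smoothCircle)

/-- A test function as a function on the circle. -/
def toFun (φ : TestFunction) : Circle → ℂ := Subtype.val φ

/-- A test function as a function of the angle. -/
def angle (φ : TestFunction) (θ : ℝ) : ℂ := φ.toFun (Circle.exp θ)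

theorem contDiff_angle (φ : TestFunction) : ContDiff ℝ ∞ φ.angle := Subtype.property φ

theorem angle_add (φ ψ : TestFunction) : (φ + ψ).angle = φ.angle + ψ.angle := rfl

theorem angle_smul (c : ℂ) (φ : TestFunction) : (c • φ).angle = c • φ.angle := rfl

theorem periodic_angle (φ : TestFunction) : Function.Periodic φ.angle (2 * Real.pi) := by
  intro θ
  simp only [angle, Circle.periodic_exp θ]

theorem continuous_iteratedDeriv (φ : TestFunction) (j : ℕ) :
    Continuous (iteratedDeriv j φ.angle) :=
  φ.contDiff_angle.continuous_iteratedDeriv j (by exact_mod_cast le_top)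

theorem bddAbove (φ : TestFunction) (j : ℕ) :
    BddAbove (Set.range fun θ : ℝ => ‖iteratedDeriv j φ.angle θ‖) := by
  have hper : Function.Periodic (iteratedDeriv j φ.angle) (2 * Real.pi) := by
    intro θ
    have h := congrFun (iteratedDeriv_comp_add_const j φ.angle (2 * Real.pi)) θ
    rw [← h]
    congr 1
    funext t
    exact φ.periodic_angle t
  have hb := hper.isBounded_of_continuous (by positivity) (φ.continuous_iteratedDeriv j)
  obtain ⟨C, hC⟩ := hb.exists_norm_le
  refine ⟨C, ?_⟩
  rintro _ ⟨θ, rfl⟩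
  exact hC _ ⟨θ, rfl⟩

/-- The seminorm `φ ↦ sup_θ |(d/dθ)^j φ(e^{iθ})|`. -/
def supSeminorm (j : ℕ) : Seminorm ℂ TestFunction :=
  Seminorm.of (fun φ => ⨆ θ : ℝ, ‖iteratedDeriv j φ.angle θ‖)
    (by
      intro φ ψ
      refine ciSup_le fun θ => ?_
      have hφ : ContDiffAt ℝ j φ.angle θ :=
        (φ.contDiff_angle.of_le (by exact_mod_cast le_top)).contDiffAt
      have hψ : ContDiffAt ℝ j ψ.angle θ :=
        (ψ.contDiff_angle.of_le (by exact_mod_cast le_top)).contDiffAt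
      rw [angle_add, iteratedDeriv_add hφ hψ]
      exact (norm_add_le _ _).trans
        (add_le_add (le_ciSup (φ.bddAbove j) θ) (le_ciSup (ψ.bddAbove j) θ)))
    (by
      intro c φ
      rw [Real.mul_iSup_of_nonneg (norm_nonneg c)]
      congr 1
      funext θ
      have hφ : ContDiffAt ℝ j φ.angle θ :=
        (φ.contDiff_angle.of_le (by exact_mod_cast le_top)).contDiffAt
      rw [angle_smul, iteratedDeriv_const_smul hφ, norm_smul])

/-- The usual topology of `C^∞(𝕋)`: uniform convergence of all derivatives. -/
instance : TopologicalSpace TestFunction :=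
  (SeminormFamily.moduleFilterBasis (𝕜 := ℂ) (ι := ℕ) supSeminorm).topology

theorem withSeminorms : WithSeminorms (𝕜 := ℂ) (ι := ℕ) supSeminorm := ⟨rfl⟩

end TestFunction

/-- The space `𝓓'(𝕋)` of distributions on the unit circle: continuous linear functionals on
`C^∞(𝕋)`. -/
abbrev CircleDistribution : Type := TestFunction →L[ℂ] ℂ

/-! ### α-harmonic functions -/

/-- The Wirtinger derivative `∂ = (∂_x - i ∂_y) / 2`. -/
def wirtinger (u : ℂ → ℂ) (z : ℂ) : ℂ :=
  (fderiv ℝ u z 1 - Complex.I * fderiv ℝ u z Complex.I) / 2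

/-- The Wirtinger derivative `∂̄ = (∂_x + i ∂_y) / 2`. -/
def wirtingerBar (u : ℂ → ℂ) (z : ℂ) : ℂ :=
  (fderiv ℝ u z 1 + Complex.I * fderiv ℝ u z Complex.I) / 2

/-- The α-Laplacian `∂ (1 - |z|²)^{-α} ∂̄` of the unit disc. -/
def alphaLaplacian (α : ℝ) (u : ℂ → ℂ) : ℂ → ℂ :=
  wirtinger fun w => (((1 - ‖w‖ ^ 2) ^ (-α) : ℝ) : ℂ) * wirtingerBar u w

/-- `u` is α-harmonic in the open unit disc. -/
def IsAlphaHarmonic (α : ℝ) (u : ℂ → ℂ) : Prop :=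
  ContDiffOn ℝ 2 u (Metric.ball 0 1) ∧ ∀ z ∈ Metric.ball (0 : ℂ) 1, alphaLaplacian α u z = 0

/-- `u` is of temperate growth in the open unit disc. -/
def TemperateInDisc (u : ℂ → ℂ) : Prop :=
  ∃ C N : ℝ, 0 < C ∧ 0 < N ∧ ∀ z ∈ Metric.ball (0 : ℂ) 1, ‖u z‖ ≤ C * (1 - ‖z‖ ^ 2) ^ (-N)

/-- The building blocks of the series expansion of α-harmonic functions: `z^k` for `k ≥ 0`, and
`F(-α, m; m+1; |z|²) z̄^m` for `k = -m < 0`. -/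
def basicFunction (α : ℝ) (k : ℤ) (z : ℂ) : ℂ :=
  if 0 ≤ k then z ^ k.natAbs
  else ((ordinaryHypergeometric (-α) (k.natAbs : ℝ) (k.natAbs + 1 : ℝ) (‖z‖ ^ 2) : ℝ) : ℂ)
    * (conj z) ^ k.natAbs

/-- `c` is the sequence of coefficients of a series expansion of `u` in the unit disc, with
`limsup_{|k| → ∞} |c_k|^{1/|k|} ≤ 1`. -/
def IsCoefficientSequence (α : ℝ) (u : ℂ → ℂ) (c : ℤ → ℂ) : Prop :=
  Filter.limsup (fun k : ℤ => ‖c k‖ₑ ^ (1 / (k.natAbs : ℝ))) Filter.cofinite ≤ 1 ∧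
    ∀ z ∈ Metric.ball (0 : ℂ) 1, HasSum (fun k : ℤ => c k * basicFunction α k z) (u z)

/-- The spectrum of an α-harmonic function: the set of those `k` for which the coefficient `c_k`
of its series expansion is non-zero. -/
def spec (α : ℝ) (u : ℂ → ℂ) : Set ℤ :=
  {k | ∃ c : ℤ → ℂ, IsCoefficientSequence α u c ∧ c k ≠ 0}

/-! ### Poisson integrals of distributions -/

/-- The α-harmonic Poisson kernel
`P_α(z) = (1 - |z|²)^{α+1} / ((1 - z) (1 - z̄)^{α+1})` (principal branch). -/
def poissonKernel (α : ℝ) (z : ℂ) : ℂ :=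
  (((1 - ‖z‖ ^ 2) ^ (α + 1) : ℝ) : ℂ) / ((1 - z) * (1 - conj z) ^ ((α + 1 : ℝ) : ℂ))

theorem contDiffAt_poissonKernel (α : ℝ) {z : ℂ} (hz : ‖z‖ < 1) :
    ContDiffAt ℝ ∞ (poissonKernel α) z := by
  have h1 : (1 : ℂ) - z ≠ 0 := by
    intro h
    rw [← sub_eq_zero.mp h] at hz
    simp at hz
  have hre : 0 < ((1 : ℂ) - conj z).re := by
    have := (Complex.re_le_norm z).trans_lt hz
    simpa using this
  have h2 : (1 : ℂ) - conj z ∈ Complex.slitPlane := Or.inl hre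
  have h3 : (1 : ℂ) - conj z ≠ 0 := Complex.slitPlane_ne_zero h2
  have hn : (1 : ℝ) - ‖z‖ ^ 2 ≠ 0 := by
    have : ‖z‖ ^ 2 < 1 := by nlinarith [norm_nonneg z]
    linarith
  have hconj : ContDiffAt ℝ ∞ (fun w : ℂ => (1 : ℂ) - conj w) z :=
    contDiffAt_const.sub Complex.conjCLE.contDiff.contDiffAt
  have hnum : ContDiffAt ℝ ∞ (fun w : ℂ => (((1 - ‖w‖ ^ 2) ^ (α + 1) : ℝ) : ℂ)) z :=
    Complex.ofRealCLM.contDiff.contDiffAt.comp z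
      ((contDiffAt_const.sub (contDiff_norm_sq ℝ).contDiffAt).rpow_const_of_ne hn)
  have hpow : ContDiffAt ℝ ∞ (fun w : ℂ => ((1 : ℂ) - conj w) ^ ((α + 1 : ℝ) : ℂ)) z := by
    have hexp : ContDiffAt ℝ ∞
        (fun w : ℂ => Complex.exp (Complex.log (1 - conj w) * ((α + 1 : ℝ) : ℂ))) z := by
      have hlog : ContDiffAt ℝ ∞ Complex.log ((1 : ℂ) - conj z) :=
        (Complex.contDiffAt_log h2).restrict_scalars ℝ
      exact ((hlog.comp z hconj).mul contDiffAt_const).cexp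
    refine hexp.congr_of_eventuallyEq ?_
    filter_upwards [hconj.continuousAt.eventually_ne h3] with w hw
    rw [Complex.cpow_def_of_ne_zero hw]
  have hden : ContDiffAt ℝ ∞
      (fun w : ℂ => (1 - w) * ((1 : ℂ) - conj w) ^ ((α + 1 : ℝ) : ℂ)) z :=
    (contDiffAt_const.sub contDiffAt_id).mul hpow
  have hden0 : (1 - z) * ((1 : ℂ) - conj z) ^ ((α + 1 : ℝ) : ℂ) ≠ 0 :=
    mul_ne_zero h1 (by simp [Complex.cpow_eq_zero_iff, h3])
  refine (hnum.mul (hden.inv hden0)).congr_of_eventuallyEq ?_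
  exact Filter.Eventually.of_forall fun w => div_eq_mul_inv _ _

/-- For `z` in the unit disc, the test function `ζ ↦ P_α(z ζ̄)` on the unit circle. -/
def poissonTestFunction (α : ℝ) (z : Metric.ball (0 : ℂ) 1) : TestFunction :=
  ⟨fun ζ => poissonKernel α (z * conj (ζ : ℂ)), by
    change ContDiff ℝ ∞ fun θ : ℝ => poissonKernel α (z * conj (Circle.exp θ : ℂ))
    rw [contDiff_iff_contDiffAt]
    intro θ
    have hz : ‖(z : ℂ) * conj (Circle.exp θ : ℂ)‖ < 1 := by
      have h := mem_ball_zero_iff.mp z.2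
      simpa [Complex.norm_mul] using h
    have he : ContDiff ℝ ∞ fun θ : ℝ => (z : ℂ) * conj (Circle.exp θ : ℂ) := by
      simp only [Circle.coe_exp]
      exact contDiff_const.mul (Complex.conjCLE.contDiff.comp
        ((Complex.ofRealCLM.contDiff.mul contDiff_const).cexp))
    exact (contDiffAt_poissonKernel α hz).comp θ he.contDiffAt⟩

/-- The α-harmonic Poisson integral of a distribution `f` on the circle. With `z = r e^{iθ}`, it is
the value at `e^{iθ}` of the convolution of the test function `e^{iτ} ↦ P_α(r e^{iτ})` with `f`,
that is, `f` applied to `e^{iτ} ↦ P_α(z e^{-iτ})`. -/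
def poissonIntegral (α : ℝ) (f : CircleDistribution) (z : Metric.ball (0 : ℂ) 1) : ℂ :=
  f (poissonTestFunction α z)

end AlphaHarmonic

end

/-!
Why the theorem holds.

*The structure of α-harmonic functions.* For `G` holomorphic in the unit disc put
`v(z) = ∫₀¹ z̄ G(t z̄) (1 - t |z|²)^α dt` (`dbarPrimitive`). The `∂̄`-derivative of the integrand is
`d/dt (t G(t z̄) (1 - t |z|²)^α)`, so that `∂̄v = (1 - |z|²)^α G(z̄)`. If `u` is α-harmonic, then
`(1 - |z|²)^{-α} ∂̄u` is killed by `∂`, hence is of the form `G(z̄)`, and `u - v` is holomorphic.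
So the α-harmonic functions are exactly the sums of a holomorphic function and a `dbarPrimitive`
(`isAlphaHarmonic_iff`). Termwise integration, with Euler's integral for the hypergeometric
function, turns the power series of the two holomorphic functions into the expansion of `u`.
The same integral bounds the hypergeometric factors between `(1 - |z|²)^{|α|}` and
`(1 - |z|²)^{-|α|}`; in particular they do not vanish, and as the terms of the expansion are the
Fourier coefficients of `u` on circles about `0`, the coefficients are unique (`coeff_unique`).

*The Poisson kernel.* The function `(1 - t |z|²)^{α+1} / ((1 - z) (1 - t z̄)^{α+1})` of `t` goes from
`1 / (1 - z)` to `P_α(z)`, and its derivative is the integrand of a `dbarPrimitive`. This gives the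
coefficients `a_k` of `P_α`: they are `1` for `k ≥ 0` and `(α+1)_m / m!` for `k = -m < 0`. Comparing
successive quotients, one sees that `a_k` and the inverses of the nonzero `a_k` are of polynomial
growth, and that no `a_k` vanishes unless `α` is a negative integer.

*Growth.* An expansion with coefficients of polynomial growth defines an α-harmonic function of
temperate growth, and conversely the coefficients of a function of temperate growth are of
polynomial growth, by the Fourier coefficients on the circle of radius `1 - 1 / (2 (|k| + 1))`
(`polyGrowth_of_temperateInDisc`).

*Distributions.* The Fourier coefficients of distributions are precisely the families of polynomial
growth (`polyGrowth_apply_modeTest`, `exists_distribution`). The expansion of `ζ ↦ P_α(z ζ̄)`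
converges in `C^∞(𝕋)`, so that the Poisson integral of `f` has the coefficients `a_k f(ζ^{-k})`
(`hasSum_poissonIntegral`). Hence Poisson integrals are α-harmonic and of temperate growth, with
spectrum in that of `P_α`; and given such a `u` with coefficients `c_k`, the distribution with
`f(ζ^{-k}) = c_k / a_k` where `a_k ≠ 0`, and `0` elsewhere, has the Poisson integral `u`.
-/

open scoped ContDiff ComplexConjugate
open MeasureTheory Set Topology

namespace AlphaHarmonic

/-! ### Integrals depending on a parameter -/

theorem continuousOn_integral_param {E F : Type} [NormedAddCommGroup E] [NormedSpace ℝ E]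
    [ProperSpace E] [NormedAddCommGroup F] [NormedSpace ℝ F]
    {Ω : Set (E × ℝ)} {U : Set E} (hU : IsOpen U)
    (hUΩ : ∀ z ∈ U, ∀ t ∈ Icc (0 : ℝ) 1, (z, t) ∈ Ω) {H : E × ℝ → F} (hH : ContinuousOn H Ω) :
    ContinuousOn (fun z => ∫ t in (0 : ℝ)..1, H (z, t)) U := by
  intro z₀ hz₀
  refine ContinuousAt.continuousWithinAt ?_
  obtain ⟨δ, hδ, hball⟩ := Metric.nhds_basis_closedBall.mem_iff.mp (hU.mem_nhds hz₀)
  have hK : IsCompact (Metric.closedBall z₀ δ ×ˢ Icc (0 : ℝ) 1) :=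
    (isCompact_closedBall z₀ δ).prod isCompact_Icc
  have hKΩ : Metric.closedBall z₀ δ ×ˢ Icc (0 : ℝ) 1 ⊆ Ω := fun p hp => hUΩ _ (hball hp.1) _ hp.2
  obtain ⟨C, hC⟩ := hK.exists_bound_of_continuousOn (hH.mono hKΩ)
  have hIoc : Set.uIoc (0 : ℝ) 1 ⊆ Icc 0 1 := by
    rw [uIoc_of_le zero_le_one]; exact Ioc_subset_Icc_self
  refine intervalIntegral.continuousAt_of_dominated_interval (bound := fun _ => C) ?_ ?_ ?_ ?_
  · filter_upwards [Metric.closedBall_mem_nhds z₀ hδ] with z hz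
    refine ContinuousOn.aestronglyMeasurable ?_ measurableSet_uIoc
    exact hH.comp (by fun_prop) fun t ht => hUΩ z (hball hz) t (hIoc ht)
  · filter_upwards [Metric.closedBall_mem_nhds z₀ hδ] with z hz
    exact Filter.Eventually.of_forall fun t ht => hC _ ⟨hz, hIoc ht⟩
  · exact intervalIntegrable_const
  · refine Filter.Eventually.of_forall fun t ht => ?_
    have h1 : ContinuousOn (fun z => H (z, t)) U :=
      hH.comp (by fun_prop) fun z hz => hUΩ z hz t (hIoc ht)
    exact h1.continuousAt (hU.mem_nhds hz₀)

/-- Differentiation under the integral sign over `[0, 1]`, for a continuously differentiable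
integrand. -/
theorem hasFDerivAt_integral_param {E F : Type} [NormedAddCommGroup E] [NormedSpace ℝ E]
    [ProperSpace E] [NormedAddCommGroup F] [NormedSpace ℝ F]
    {Ω : Set (E × ℝ)} (hΩ : IsOpen Ω) {U : Set E} (hU : IsOpen U)
    (hUΩ : ∀ z ∈ U, ∀ t ∈ Icc (0 : ℝ) 1, (z, t) ∈ Ω) {H : E × ℝ → F} (hH : ContDiffOn ℝ 1 H Ω)
    {z₀ : E} (hz₀ : z₀ ∈ U) :
    HasFDerivAt (fun z => ∫ t in (0 : ℝ)..1, H (z, t))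
      (∫ t in (0 : ℝ)..1, (fderiv ℝ H (z₀, t)).comp (.inl ℝ E ℝ)) z₀ := by
  obtain ⟨δ, hδ, hball⟩ := Metric.nhds_basis_closedBall.mem_iff.mp (hU.mem_nhds hz₀)
  have hK : IsCompact (Metric.closedBall z₀ δ ×ˢ Icc (0 : ℝ) 1) :=
    (isCompact_closedBall z₀ δ).prod isCompact_Icc
  have hKΩ : Metric.closedBall z₀ δ ×ˢ Icc (0 : ℝ) 1 ⊆ Ω := fun p hp => hUΩ _ (hball hp.1) _ hp.2
  have hD : ContinuousOn (fun p => (fderiv ℝ H p).comp (.inl ℝ E ℝ)) Ω :=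
    (hH.continuousOn_fderiv_of_isOpen hΩ le_rfl).clm_comp continuousOn_const
  obtain ⟨C, hC⟩ := hK.exists_bound_of_continuousOn (hD.mono hKΩ)
  have hIoc : Set.uIoc (0 : ℝ) 1 ⊆ Icc 0 1 := by
    rw [uIoc_of_le zero_le_one]; exact Ioc_subset_Icc_self
  have hline : ∀ z ∈ U, ContinuousOn (fun t => H (z, t)) (Icc 0 1) := fun z hz =>
    hH.continuousOn.comp (by fun_prop) fun t ht => hUΩ z hz t ht
  refine intervalIntegral.hasFDerivAt_integral_of_dominated_of_fderiv_le
    (F' := fun z t => (fderiv ℝ H (z, t)).comp (.inl ℝ E ℝ)) (bound := fun _ => C)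
    (Metric.closedBall_mem_nhds z₀ hδ) ?_ ?_ ?_ ?_ ?_ ?_
  · filter_upwards [Metric.closedBall_mem_nhds z₀ hδ] with z hz
    exact ((hline z (hball hz)).mono hIoc).aestronglyMeasurable measurableSet_uIoc
  · refine ContinuousOn.intervalIntegrable ?_
    rw [uIcc_of_le zero_le_one]
    exact hline z₀ hz₀
  · refine ContinuousOn.aestronglyMeasurable ?_ measurableSet_uIoc
    exact hD.comp (f := fun t : ℝ => (z₀, t)) (by fun_prop) fun t ht => hUΩ z₀ hz₀ t (hIoc ht)
  · exact Filter.Eventually.of_forall fun t ht z hz => hC _ ⟨hz, hIoc ht⟩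
  · exact intervalIntegrable_const
  · refine Filter.Eventually.of_forall fun t ht z hz => ?_
    have h1 : HasFDerivAt H (fderiv ℝ H (z, t)) (z, t) :=
      ((hH.contDiffAt (hΩ.mem_nhds (hUΩ z (hball hz) t (hIoc ht)))).differentiableAt
        (by simp)).hasFDerivAt
    exact h1.comp z (hasFDerivAt_prodMk_left z t)

/-- Smooth dependence on the parameter. The induction on `n` replaces the integrand by its partial
differential, which takes values in another space. -/
theorem contDiffOn_integral_param (n : ℕ) : ∀ {E F : Type} [NormedAddCommGroup E]
    [NormedSpace ℝ E] [ProperSpace E] [NormedAddCommGroup F] [NormedSpace ℝ F]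
    {Ω : Set (E × ℝ)} (_ : IsOpen Ω) {U : Set E} (_ : IsOpen U)
    (_ : ∀ z ∈ U, ∀ t ∈ Icc (0 : ℝ) 1, (z, t) ∈ Ω) {H : E × ℝ → F} (_ : ContDiffOn ℝ n H Ω),
    ContDiffOn ℝ n (fun z => ∫ t in (0 : ℝ)..1, H (z, t)) U := by
  induction n with
  | zero =>
    intro E F _ _ _ _ _ Ω hΩ U hU hUΩ H hH
    simp only [Nat.cast_zero, contDiffOn_zero] at hH ⊢
    exact continuousOn_integral_param hU hUΩ hH
  | succ n ih =>
    intro E F _ _ _ _ _ Ω hΩ U hU hUΩ H hH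
    push_cast at hH ⊢
    have h1 : ContDiffOn ℝ 1 H Ω := hH.of_le (by exact_mod_cast Nat.le_add_left 1 n)
    have hD : ContDiffOn ℝ n (fun p => (fderiv ℝ H p).comp (.inl ℝ E ℝ)) Ω :=
      (hH.fderiv_of_isOpen hΩ le_rfl).clm_comp contDiffOn_const
    rw [contDiffOn_succ_iff_fderiv_of_isOpen hU]
    refine ⟨fun z hz => (hasFDerivAt_integral_param hΩ hU hUΩ h1 hz).differentiableAt
      |>.differentiableWithinAt, by simp, ?_⟩
    exact (ih hΩ hU hUΩ hD).congr fun z hz => (hasFDerivAt_integral_param hΩ hU hUΩ h1 hz).fderiv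

/-! ### Wirtinger derivatives -/

/-- `u` is real differentiable at `z` with Wirtinger derivatives `∂u = a` and `∂̄u = b`: its
differential is `v ↦ a v + b v̄`. -/
def HasWirtingerAt (u : ℂ → ℂ) (a b z : ℂ) : Prop :=
  HasFDerivAt u (a • ContinuousLinearMap.id ℝ ℂ + b • (Complex.conjCLE : ℂ →L[ℝ] ℂ)) z

namespace HasWirtingerAt

variable {u v : ℂ → ℂ} {a b c d z : ℂ}

theorem wirtinger_eq (h : HasWirtingerAt u a b z) : wirtinger u z = a := by
  rw [wirtinger, HasFDerivAt.fderiv h]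
  simp
  linear_combination (-(a - b) / 2) * Complex.I_mul_I

theorem wirtingerBar_eq (h : HasWirtingerAt u a b z) : wirtingerBar u z = b := by
  rw [wirtingerBar, HasFDerivAt.fderiv h]
  simp
  linear_combination ((a - b) / 2) * Complex.I_mul_I

theorem congr_of_eventuallyEq (h : HasWirtingerAt u a b z) (hv : v =ᶠ[𝓝 z] u) :
    HasWirtingerAt v a b z := HasFDerivAt.congr_of_eventuallyEq h hv

theorem congr_values (h : HasWirtingerAt u a b z) (ha : a = c) (hb : b = d) :
    HasWirtingerAt u c d z := ha ▸ hb ▸ h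

theorem add (h : HasWirtingerAt u a b z) (h' : HasWirtingerAt v c d z) :
    HasWirtingerAt (fun w => u w + v w) (a + c) (b + d) z := by
  refine (HasFDerivAt.add h h').congr_fderiv ?_
  ext w
  simp
  ring

theorem sub (h : HasWirtingerAt u a b z) (h' : HasWirtingerAt v c d z) :
    HasWirtingerAt (fun w => u w - v w) (a - c) (b - d) z := by
  refine (HasFDerivAt.sub h h').congr_fderiv ?_
  ext w
  simp
  ring

theorem mul (h : HasWirtingerAt u a b z) (h' : HasWirtingerAt v c d z) :
    HasWirtingerAt (fun w => u w * v w) (u z * c + a * v z) (u z * d + b * v z) z := by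
  refine (HasFDerivAt.mul h h').congr_fderiv ?_
  ext w
  simp
  ring

theorem comp_hasDerivAt {g : ℂ → ℂ} {g' : ℂ} (hg : HasDerivAt g g' (u z))
    (h : HasWirtingerAt u a b z) : HasWirtingerAt (fun w => g (u w)) (g' * a) (g' * b) z := by
  refine ((hg.hasFDerivAt.restrictScalars ℝ).comp z h).congr_fderiv ?_
  ext w
  simp
  ring

end HasWirtingerAt

theorem hasWirtingerAt_const (c z : ℂ) : HasWirtingerAt (fun _ => c) 0 0 z :=
  (hasFDerivAt_const c z).congr_fderiv (by ext; simp)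

theorem hasWirtingerAt_id (z : ℂ) : HasWirtingerAt (fun w => w) 1 0 z :=
  (hasFDerivAt_id z).congr_fderiv (by ext; simp)

theorem hasWirtingerAt_conj (z : ℂ) : HasWirtingerAt (fun w => conj w) 0 1 z :=
  (Complex.conjCLE.hasFDerivAt (x := z)).congr_fderiv (by ext; simp)

theorem hasWirtingerAt_of_hasDerivAt {g : ℂ → ℂ} {g' z : ℂ} (hg : HasDerivAt g g' z) :
    HasWirtingerAt g g' 0 z := by
  simpa using (hasWirtingerAt_id z).comp_hasDerivAt hg

theorem hasWirtingerAt_of_differentiableAt {u : ℂ → ℂ} {z : ℂ} (h : DifferentiableAt ℝ u z) :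
    HasWirtingerAt u (wirtinger u z) (wirtingerBar u z) z := by
  refine h.hasFDerivAt.congr_fderiv ?_
  ext w
  have h1 : fderiv ℝ u z w = w.re * fderiv ℝ u z 1 + w.im * fderiv ℝ u z Complex.I := by
    have h2 : w = w.re • (1 : ℂ) + w.im • Complex.I := by simp
    conv_lhs => rw [h2, map_add, map_smul, map_smul]
    simp
  have h3 : conj w = w.re - w.im * Complex.I := by
    apply Complex.ext <;> simp
  simp only [wirtinger, wirtingerBar, h1, add_apply, smul_apply, ContinuousLinearMap.coe_id', id_eq,
    smul_eq_mul, ContinuousLinearEquiv.coe_coe, Complex.conjCLE_apply, h3]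
  conv_rhs => rw [← Complex.re_add_im w]
  simp only [Complex.add_re, Complex.add_im, Complex.ofReal_re, Complex.ofReal_im, Complex.mul_re,
    Complex.mul_im, Complex.I_re, Complex.I_im]
  push_cast
  linear_combination (w.im * fderiv ℝ u z Complex.I) * Complex.I_mul_I

/-- The Cauchy–Riemann equation `∂̄u = 0` implies complex differentiability. -/
theorem HasWirtingerAt.hasDerivAt {u : ℂ → ℂ} {a z : ℂ} (h : HasWirtingerAt u a 0 z) :
    HasDerivAt u a z := by
  have h1 : HasFDerivAt u ((a • (ContinuousLinearMap.id ℂ ℂ)).restrictScalars ℝ) z :=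
    HasFDerivAt.congr_fderiv h (by ext; simp)
  have h2 := (hasFDerivAt_of_restrictScalars ℝ h1 rfl).hasDerivAt
  simpa using h2

theorem conj_mem_unitBall {z : ℂ} : conj z ∈ Metric.ball (0 : ℂ) 1 ↔ z ∈ Metric.ball (0 : ℂ) 1 := by
  simp

/-- A `C¹` function killed by `∂` is a holomorphic function of `z̄`. -/
theorem differentiableOn_comp_conj {W : ℂ → ℂ}
    (hW : ∀ z ∈ Metric.ball (0 : ℂ) 1, DifferentiableAt ℝ W z ∧ wirtinger W z = 0) :
    DifferentiableOn ℂ (fun w => W (conj w)) (Metric.ball 0 1) := by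
  intro z hz
  have h1 := hW _ (conj_mem_unitBall.mpr hz)
  have h2 := hasWirtingerAt_of_differentiableAt h1.1
  rw [h1.2] at h2
  have h3 : HasWirtingerAt (fun w => W (conj w)) (wirtingerBar W (conj z)) 0 z := by
    refine (HasFDerivAt.comp z h2 (Complex.conjCLE.hasFDerivAt (x := z))).congr_fderiv ?_
    ext
    simp
  exact h3.hasDerivAt.differentiableAt.differentiableWithinAt

/-! ### The primitive operator -/

/-- The complex number `1 - t |z|²`, written as a polynomial in `z` and `z̄`. -/
noncomputable def polarWeight (z : ℂ) (t : ℝ) : ℂ := 1 - t * (z * conj z)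

theorem polarWeight_eq (z : ℂ) (t : ℝ) : polarWeight z t = ((1 - t * ‖z‖ ^ 2 : ℝ) : ℂ) := by
  rw [polarWeight, Complex.mul_conj']; push_cast; ring

/-- The open set of `(z, t)` with `|z| < 1` and `|t z| < 1`, on which the integrand of
`dbarPrimitive` is smooth: an open neighbourhood of `𝔻 × [0, 1]`. -/
def polarDomain : Set (ℂ × ℝ) := {p | ‖p.1‖ < 1 ∧ ‖(p.2 : ℂ) * p.1‖ < 1}

theorem isOpen_polarDomain : IsOpen polarDomain :=
  (isOpen_lt (f := fun p : ℂ × ℝ => ‖p.1‖) (by fun_prop) continuous_const).inter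
    (isOpen_lt (f := fun p : ℂ × ℝ => ‖(p.2 : ℂ) * p.1‖) (by fun_prop) continuous_const)

theorem mem_polarDomain {z : ℂ} (hz : z ∈ Metric.ball (0 : ℂ) 1) {t : ℝ} (ht : t ∈ Icc (0 : ℝ) 1) :
    (z, t) ∈ polarDomain := by
  have h := mem_ball_zero_iff.mp hz
  refine ⟨h, ?_⟩
  have h1 : ‖((t : ℝ) : ℂ)‖ ≤ 1 := by
    rw [Complex.norm_real, Real.norm_eq_abs, abs_of_nonneg ht.1]; exact ht.2
  simp only [norm_mul]
  nlinarith [norm_nonneg z]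

theorem one_sub_mul_norm_sq_pos {p : ℂ × ℝ} (hp : p ∈ polarDomain) : 0 < 1 - p.2 * ‖p.1‖ ^ 2 := by
  obtain ⟨h1, h2⟩ := hp
  rw [norm_mul, Complex.norm_real, Real.norm_eq_abs] at h2
  have h3 := le_abs_self p.2
  have h4 : p.2 * ‖p.1‖ ≤ |p.2| * ‖p.1‖ := by gcongr
  have h5 : |p.2| * ‖p.1‖ * ‖p.1‖ ≤ |p.2| * ‖p.1‖ * 1 := by gcongr
  nlinarith [norm_nonneg p.1, mul_le_mul_of_nonneg_right h4 (norm_nonneg p.1)]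

theorem polarWeight_mem_slitPlane {p : ℂ × ℝ} (hp : p ∈ polarDomain) :
    polarWeight p.1 p.2 ∈ Complex.slitPlane := by
  rw [polarWeight_eq]
  exact Or.inl (by rw [Complex.ofReal_re]; exact one_sub_mul_norm_sq_pos hp)

theorem polar_mem_ball {p : ℂ × ℝ} (hp : p ∈ polarDomain) :
    (p.2 : ℂ) * conj p.1 ∈ Metric.ball (0 : ℂ) 1 := by
  rw [mem_ball_zero_iff, norm_mul, Complex.norm_conj, ← norm_mul]; exact hp.2

theorem contDiffOn_real_of_differentiableOn {g : ℂ → ℂ} {S : Set ℂ} (hS : IsOpen S)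
    (hg : DifferentiableOn ℂ g S) (n : ℕ∞ω) : ContDiffOn ℝ n g S :=
  (hg.contDiffOn hS).restrict_scalars ℝ

/-- The integrand `z̄ G(t z̄) (1 - t |z|²)^α` of `dbarPrimitive`, as a function of `(z, t)`. The power
is a complex one, so that the Wirtinger calculus applies to it. -/
noncomputable def dbarIntegrand (α : ℝ) (G : ℂ → ℂ) (p : ℂ × ℝ) : ℂ :=
  conj p.1 * G (p.2 * conj p.1) * polarWeight p.1 p.2 ^ (α : ℂ)

/-- For `G` holomorphic in the disc, this is the solution of `∂̄v = (1 - |z|²)^α G(z̄)` which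
corresponds to `v = F(-α, m; m+1; |z|²) z̄^m` when `G(w) = m w^{m-1}`. -/
noncomputable def dbarPrimitive (α : ℝ) (G : ℂ → ℂ) (z : ℂ) : ℂ :=
  ∫ t in (0 : ℝ)..1, dbarIntegrand α G (z, t)

theorem contDiffOn_dbarIntegrand (α : ℝ) {G : ℂ → ℂ}
    (hG : DifferentiableOn ℂ G (Metric.ball 0 1)) (n : ℕ∞ω) :
    ContDiffOn ℝ n (dbarIntegrand α G) polarDomain := by
  have hconj : ContDiff ℝ n fun p : ℂ × ℝ => conj p.1 :=
    Complex.conjCLE.contDiff.comp contDiff_fst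
  have hofReal : ContDiff ℝ n fun p : ℂ × ℝ => (p.2 : ℂ) :=
    Complex.ofRealCLM.contDiff.comp contDiff_snd
  have h1 : ContDiffOn ℝ n (fun p : ℂ × ℝ => G (p.2 * conj p.1)) polarDomain :=
    (contDiffOn_real_of_differentiableOn Metric.isOpen_ball hG n).comp
      (hofReal.mul hconj).contDiffOn fun p hp => polar_mem_ball hp
  have hpow : DifferentiableOn ℂ (fun w : ℂ => w ^ (α : ℂ)) Complex.slitPlane := fun w hw =>
    (differentiableAt_id.cpow_const hw).differentiableWithinAt
  have h2 : ContDiffOn ℝ n (fun p : ℂ × ℝ => polarWeight p.1 p.2 ^ (α : ℂ)) polarDomain :=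
    (contDiffOn_real_of_differentiableOn Complex.isOpen_slitPlane hpow n).comp
      (f := fun p : ℂ × ℝ => polarWeight p.1 p.2)
      (contDiff_const.sub (hofReal.mul (contDiff_fst.mul hconj))).contDiffOn
      fun p hp => polarWeight_mem_slitPlane hp
  exact (hconj.contDiffOn.mul h1).mul h2

theorem contDiffOn_dbarPrimitive (α : ℝ) {G : ℂ → ℂ}
    (hG : DifferentiableOn ℂ G (Metric.ball 0 1)) (n : ℕ) :
    ContDiffOn ℝ n (dbarPrimitive α G) (Metric.ball 0 1) :=
  contDiffOn_integral_param n isOpen_polarDomain Metric.isOpen_ball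
    (fun _ hz _ ht => mem_polarDomain hz ht) (contDiffOn_dbarIntegrand α hG n)

theorem hasDerivAt_polarWeight_cpow (β : ℂ) {z : ℂ} {t : ℝ} (hp : (z, t) ∈ polarDomain) :
    HasDerivAt (fun s : ℝ => polarWeight z s ^ β)
      (β * polarWeight z t ^ (β - 1) * (-(z * conj z))) t := by
  have h1 : HasDerivAt (fun s : ℝ => polarWeight z s) (-(z * conj z)) t := by
    have := ((Complex.ofRealCLM.hasDerivAt (x := t)).mul_const (z * conj z)).const_sub 1
    simpa [polarWeight] using this
  exact (hasDerivAt_id _).cpow_const (c := β) (x := polarWeight z t)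
    (polarWeight_mem_slitPlane hp) |>.comp_of_eq t h1 rfl |>.congr_deriv (by simp)

theorem hasWirtingerAt_dbarIntegrand (α : ℝ) {G : ℂ → ℂ}
    (hG : DifferentiableOn ℂ G (Metric.ball 0 1)) {z : ℂ} {t : ℝ} (hp : (z, t) ∈ polarDomain) :
    ∃ a, HasWirtingerAt (fun w => dbarIntegrand α G (w, t)) a
      (G (t * conj z) * polarWeight z t ^ (α : ℂ)
        + t * conj z * deriv G (t * conj z) * polarWeight z t ^ (α : ℂ)
        - α * t * (z * conj z) * G (t * conj z) * polarWeight z t ^ ((α : ℂ) - 1)) z := by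
  have hGd : HasDerivAt G (deriv G (t * conj z)) (t * conj z) :=
    (hG.differentiableAt (Metric.isOpen_ball.mem_nhds (polar_mem_ball hp))).hasDerivAt
  have h1 := HasWirtingerAt.comp_hasDerivAt (u := fun w => t * conj w) hGd
    ((hasWirtingerAt_const (t : ℂ) z).mul (hasWirtingerAt_conj z))
  have h2 : HasWirtingerAt (fun w => polarWeight w t) _ _ z :=
    (hasWirtingerAt_const 1 z).sub
      ((hasWirtingerAt_const (t : ℂ) z).mul ((hasWirtingerAt_id z).mul (hasWirtingerAt_conj z)))
  have h3 := HasWirtingerAt.comp_hasDerivAt (u := fun w => polarWeight w t)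
    ((hasDerivAt_id (polarWeight z t)).cpow_const (c := (α : ℂ))
      (polarWeight_mem_slitPlane hp)) h2
  have h4 := ((hasWirtingerAt_conj z).mul h1).mul h3
  refine ⟨_, h4.congr_values rfl ?_⟩
  simp
  ring

/-- The derivative here is the same expression as the `∂̄`-derivative in
`hasWirtingerAt_dbarIntegrand`. -/
theorem hasDerivAt_mul_comp_mul_polarWeight (α : ℝ) {G : ℂ → ℂ}
    (hG : DifferentiableOn ℂ G (Metric.ball 0 1)) {z : ℂ} {t : ℝ} (hp : (z, t) ∈ polarDomain) :
    HasDerivAt (fun s : ℝ => (s : ℂ) * G (s * conj z) * polarWeight z s ^ (α : ℂ))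
      (G (t * conj z) * polarWeight z t ^ (α : ℂ)
        + t * conj z * deriv G (t * conj z) * polarWeight z t ^ (α : ℂ)
        - α * t * (z * conj z) * G (t * conj z) * polarWeight z t ^ ((α : ℂ) - 1)) t := by
  have hGd : HasDerivAt G (deriv G (t * conj z)) (t * conj z) :=
    (hG.differentiableAt (Metric.isOpen_ball.mem_nhds (polar_mem_ball hp))).hasDerivAt
  have h0 : HasDerivAt (fun s : ℝ => (s : ℂ)) 1 t := Complex.ofRealCLM.hasDerivAt
  have h1 : HasDerivAt (fun s : ℝ => G (s * conj z)) (deriv G (t * conj z) * (1 * conj z)) t :=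
    hGd.comp t (h0.mul_const (conj z))
  refine ((h0.mul h1).mul (hasDerivAt_polarWeight_cpow α hp)).congr_deriv ?_
  simp
  ring

/-- The primitive operator solves `∂̄v = (1 - |z|²)^α G(z̄)`: differentiating under the integral
sign, the `∂̄`-derivative of the integrand is the exact `t`-derivative of
`t G(t z̄) (1 - t |z|²)^α`. -/
theorem wirtingerBar_dbarPrimitive (α : ℝ) {G : ℂ → ℂ}
    (hG : DifferentiableOn ℂ G (Metric.ball 0 1)) {z : ℂ} (hz : z ∈ Metric.ball (0 : ℂ) 1) :
    wirtingerBar (dbarPrimitive α G) z = (((1 - ‖z‖ ^ 2) ^ α : ℝ) : ℂ) * G (conj z) := by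
  have hC1 := contDiffOn_dbarIntegrand α hG 1
  have hder : HasFDerivAt (dbarPrimitive α G) _ z :=
    hasFDerivAt_integral_param isOpen_polarDomain Metric.isOpen_ball
      (fun _ hz _ ht => mem_polarDomain hz ht) hC1 hz
  have hcont : ContinuousOn
      (fun t : ℝ => (fderiv ℝ (dbarIntegrand α G) (z, t)).comp (.inl ℝ ℂ ℝ)) (Icc 0 1) :=
    ((hC1.continuousOn_fderiv_of_isOpen isOpen_polarDomain le_rfl).comp
      (f := fun t : ℝ => (z, t)) (by fun_prop) fun t ht => mem_polarDomain hz ht).clm_comp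
      continuousOn_const
  have hint := hcont.intervalIntegrable_of_Icc (μ := volume) zero_le_one
  have hpt : ∀ t ∈ Icc (0 : ℝ) 1, HasFDerivAt (fun w => dbarIntegrand α G (w, t))
      ((fderiv ℝ (dbarIntegrand α G) (z, t)).comp (.inl ℝ ℂ ℝ)) z := fun t ht =>
    ((hC1.contDiffAt (isOpen_polarDomain.mem_nhds (mem_polarDomain hz ht))).differentiableAt
        (by simp)).hasFDerivAt.comp (f := fun w => (w, t)) z (hasFDerivAt_prodMk_left z t)
  have hint1 : ∀ v : ℂ, IntervalIntegrable
      (fun t : ℝ => (fderiv ℝ (dbarIntegrand α G) (z, t)).comp (.inl ℝ ℂ ℝ) v) volume 0 1 :=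
    fun v => (hcont.clm_apply continuousOn_const).intervalIntegrable_of_Icc zero_le_one
  rw [wirtingerBar, hder.fderiv, ContinuousLinearMap.intervalIntegral_apply hint,
    ContinuousLinearMap.intervalIntegral_apply hint, ← intervalIntegral.integral_const_mul,
    ← intervalIntegral.integral_add (hint1 1) ((hint1 Complex.I).const_mul _),
    ← intervalIntegral.integral_div]
  have hFTC := intervalIntegral.integral_eq_sub_of_hasDerivAt
    (f := fun s : ℝ => (s : ℂ) * G (s * conj z) * polarWeight z s ^ (α : ℂ))
    (f' := fun t => (((fderiv ℝ (dbarIntegrand α G) (z, t)).comp (.inl ℝ ℂ ℝ) 1)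
      + Complex.I * ((fderiv ℝ (dbarIntegrand α G) (z, t)).comp (.inl ℝ ℂ ℝ) Complex.I)) / 2)
    (a := 0) (b := 1) ?_ ?_
  · rw [hFTC]
    have hpos : 0 ≤ 1 - ‖z‖ ^ 2 := by
      have := mem_ball_zero_iff.mp hz
      nlinarith [norm_nonneg z]
    rw [Complex.ofReal_cpow hpos]
    simp [polarWeight_eq]
    ring
  · intro t ht
    rw [uIcc_of_le zero_le_one] at ht
    obtain ⟨a, ha⟩ := hasWirtingerAt_dbarIntegrand α hG (mem_polarDomain hz ht)
    refine (hasDerivAt_mul_comp_mul_polarWeight α hG (mem_polarDomain hz ht)).congr_deriv ?_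
    rw [← ha.wirtingerBar_eq, wirtingerBar, (hpt t ht).fderiv]
  · exact ((hint1 1).add ((hint1 Complex.I).const_mul _)).div_const 2

/-! ### Structure of α-harmonic functions -/

theorem one_sub_norm_sq_pos {z : ℂ} (hz : z ∈ Metric.ball (0 : ℂ) 1) : 0 < 1 - ‖z‖ ^ 2 := by
  have := mem_ball_zero_iff.mp hz
  nlinarith [norm_nonneg z]

theorem differentiableAt_wirtingerBar {u : ℂ → ℂ}
    (hu : ContDiffOn ℝ 2 u (Metric.ball 0 1)) {z : ℂ} (hz : z ∈ Metric.ball (0 : ℂ) 1) :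
    DifferentiableAt ℝ (wirtingerBar u) z := by
  have h1 : ContDiffOn ℝ 1 (fderiv ℝ u) (Metric.ball 0 1) :=
    hu.fderiv_of_isOpen Metric.isOpen_ball (by norm_num)
  have h2 : DifferentiableAt ℝ (fderiv ℝ u) z :=
    (h1.contDiffAt (Metric.isOpen_ball.mem_nhds hz)).differentiableAt (by simp)
  have h3 : ∀ v : ℂ, DifferentiableAt ℝ (fun w => fderiv ℝ u w v) z := fun v =>
    h2.clm_apply (differentiableAt_const _)
  exact ((h3 1).fun_add ((h3 Complex.I).const_mul _)).mul_const (2 : ℂ)⁻¹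

/-- The general α-harmonic function: a holomorphic function plus `dbarPrimitive α G` with `G`
holomorphic. -/
theorem isAlphaHarmonic_iff (α : ℝ) (u : ℂ → ℂ) :
    IsAlphaHarmonic α u ↔ ∃ h G : ℂ → ℂ, DifferentiableOn ℂ h (Metric.ball 0 1) ∧
      DifferentiableOn ℂ G (Metric.ball 0 1) ∧
      ∀ z ∈ Metric.ball (0 : ℂ) 1, u z = h z + dbarPrimitive α G z := by
  constructor
  · rintro ⟨hC2, hL⟩
    -- the function `(1 - |w|²)^{-α} ∂̄u` is `G(w̄)` for the `G` in question
    set W : ℂ → ℂ := fun w => (((1 - ‖w‖ ^ 2) ^ (-α) : ℝ) : ℂ) * wirtingerBar u w with hW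
    have hWd : ∀ z ∈ Metric.ball (0 : ℂ) 1, DifferentiableAt ℝ W z := by
      intro z hz
      have h1 : DifferentiableAt ℝ (fun w : ℂ => (1 - ‖w‖ ^ 2) ^ (-α)) z :=
        ((differentiableAt_const _).sub (differentiableAt_id.norm_sq ℝ)).rpow_const
          (Or.inl (one_sub_norm_sq_pos hz).ne')
      exact (Complex.ofRealCLM.differentiableAt.comp z h1).mul
        (differentiableAt_wirtingerBar hC2 hz)
    have hG := differentiableOn_comp_conj fun z hz => ⟨hWd z hz, hL z hz⟩
    refine ⟨fun z => u z - dbarPrimitive α (fun w => W (conj w)) z, fun w => W (conj w), ?_, hG,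
      fun z _ => by ring⟩
    intro z hz
    have hu := hasWirtingerAt_of_differentiableAt
      ((hC2.contDiffAt (Metric.isOpen_ball.mem_nhds hz)).differentiableAt (by simp))
    have hI := hasWirtingerAt_of_differentiableAt
      (((contDiffOn_dbarPrimitive α hG 2).contDiffAt
        (Metric.isOpen_ball.mem_nhds hz)).differentiableAt (by simp))
    refine ((hu.sub hI).congr_values rfl ?_).hasDerivAt.differentiableAt.differentiableWithinAt
    rw [wirtingerBar_dbarPrimitive α hG hz, hW]
    simp only [Complex.conj_conj]
    rw [← mul_assoc, ← Complex.ofReal_mul, ← Real.rpow_add (one_sub_norm_sq_pos hz)]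
    simp
  · rintro ⟨h, G, hh, hG, hu⟩
    have hCI : ContDiffOn ℝ 2 (dbarPrimitive α G) (Metric.ball 0 1) := by
      exact_mod_cast contDiffOn_dbarPrimitive α hG 2
    have hbar : ∀ z ∈ Metric.ball (0 : ℂ) 1,
        wirtingerBar u z = (((1 - ‖z‖ ^ 2) ^ α : ℝ) : ℂ) * G (conj z) := by
      intro z hz
      have hn := Metric.isOpen_ball.mem_nhds hz
      have h1 := hasWirtingerAt_of_hasDerivAt (hh.differentiableAt hn).hasDerivAt
      have h2 := hasWirtingerAt_of_differentiableAt
        ((hCI.contDiffAt hn).differentiableAt (by simp))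
      have h3 := (h1.add h2).congr_of_eventuallyEq (Filter.eventually_of_mem hn hu)
      rw [h3.wirtingerBar_eq, zero_add, wirtingerBar_dbarPrimitive α hG hz]
    refine ⟨((contDiffOn_real_of_differentiableOn Metric.isOpen_ball hh 2).add hCI).congr hu,
      fun z hz => ?_⟩
    have hn := Metric.isOpen_ball.mem_nhds hz
    have h4 := (hasWirtingerAt_conj z).comp_hasDerivAt (hG.differentiableAt
      (Metric.isOpen_ball.mem_nhds (conj_mem_unitBall.mpr hz))).hasDerivAt
    refine (h4.congr_of_eventuallyEq (Filter.eventually_of_mem hn fun w hw => ?_)).wirtinger_eq.trans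
      (mul_zero _)
    simp only
    rw [hbar w hw, ← mul_assoc, ← Complex.ofReal_mul, ← Real.rpow_add (one_sub_norm_sq_pos hw)]
    simp

/-! ### Euler's integral and series expansions -/

/-- Mathlib's binomial series is in terms of `Ring.choose`, its hypergeometric series in terms of
`ascPochhammer`. -/
theorem ring_choose_eq_ascPochhammer_div {R : Type*} [Field R] [CharZero R] (a : R) (n : ℕ) :
    Ring.choose (a + n - 1) n = (ascPochhammer R n).eval a / n.factorial := by
  rw [← Ring.multichoose_eq, ← Polynomial.ascPochhammer_smeval_eq_eval,
    ← Ring.factorial_nsmul_multichoose_eq_ascPochhammer, nsmul_eq_mul,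
    mul_div_cancel_left₀ _ (by exact_mod_cast n.factorial_ne_zero)]

theorem hasSum_one_sub_rpow (α : ℝ) {y : ℝ} (hy : |y| < 1) :
    HasSum (fun n : ℕ => (ascPochhammer ℝ n).eval (-α) / n.factorial * y ^ n) ((1 - y) ^ α) := by
  have h := (Real.one_div_one_sub_rpow_hasFPowerSeriesOnBall_zero (-α)).hasSum (y := y)
    (by simpa [enorm_eq_nnnorm, ← NNReal.coe_lt_coe] using hy)
  simp only [FormalMultilinearSeries.ofScalars_apply_eq, ring_choose_eq_ascPochhammer_div,
    smul_eq_mul, zero_add] at h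
  rwa [Real.rpow_neg (by linarith [(abs_lt.mp hy).2]), one_div, inv_inv] at h

theorem hasSum_one_sub_cpow_neg (a : ℂ) {w : ℂ} (hw : ‖w‖ < 1) :
    HasSum (fun n : ℕ => (ascPochhammer ℂ n).eval a / n.factorial * w ^ n) ((1 - w) ^ (-a)) := by
  have h := (Complex.one_div_one_sub_cpow_hasFPowerSeriesOnBall_zero a).hasSum (y := w)
    (by simpa [enorm_eq_nnnorm, ← NNReal.coe_lt_coe] using hw)
  simp only [FormalMultilinearSeries.ofScalars_apply_eq, ring_choose_eq_ascPochhammer_div,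
    smul_eq_mul, zero_add] at h
  rwa [Complex.cpow_neg, ← one_div]

theorem ascPochhammer_eval_mul_add {R : Type*} [CommRing R] (b : R) (n : ℕ) :
    (ascPochhammer R n).eval b * (b + n) = b * (ascPochhammer R n).eval (b + 1) := by
  rw [← ascPochhammer_succ_eval, ascPochhammer_succ_left]
  simp

theorem one_sub_mul_mem {x t : ℝ} (hx0 : 0 ≤ x) (ht : t ∈ Icc (0 : ℝ) 1) :
    1 - x ≤ 1 - t * x ∧ 1 - t * x ≤ 1 := by
  have h1 := mul_le_mul_of_nonneg_right ht.2 hx0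
  have h2 := mul_nonneg ht.1 hx0
  constructor <;> linarith

theorem rpow_abs_le_rpow {α s y : ℝ} (hs : 0 < s) (hsy : s ≤ y) (hy : y ≤ 1) :
    s ^ |α| ≤ y ^ α ∧ y ^ α ≤ s ^ (-|α|) := by
  have hy0 : 0 < y := hs.trans_le hsy
  constructor
  · exact (Real.rpow_le_rpow hs.le hsy (abs_nonneg α)).trans
      (Real.rpow_le_rpow_of_exponent_ge hy0 hy (le_abs_self α))
  · exact (Real.rpow_le_rpow_of_exponent_ge hy0 hy (neg_abs_le α)).trans
      (Real.rpow_le_rpow_of_nonpos hs hsy (neg_nonpos.mpr (abs_nonneg α)))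

theorem continuousOn_one_sub_mul_rpow (α : ℝ) {x : ℝ} (hx0 : 0 ≤ x) (hx : x < 1) :
    ContinuousOn (fun t : ℝ => (1 - t * x) ^ α) (Icc 0 1) :=
  ContinuousOn.rpow_const (by fun_prop) fun t ht =>
    Or.inl (by linarith [(one_sub_mul_mem hx0 ht).1] : 0 < 1 - t * x).ne'

theorem uIoc_zero_one_subset : Set.uIoc (0 : ℝ) 1 ⊆ Icc 0 1 := by
  rw [uIoc_of_le zero_le_one]; exact Ioc_subset_Icc_self

/-- Euler's integral `F(-α, m; m+1; x) = m ∫₀¹ t^{m-1} (1 - t x)^α dt`, for `m = j + 1`. -/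
theorem ordinaryHypergeometric_eq_integral (α : ℝ) (j : ℕ) {x : ℝ} (hx0 : 0 ≤ x) (hx : x < 1) :
    ordinaryHypergeometric (-α) ((j : ℝ) + 1) ((j : ℝ) + 1 + 1) x
      = ((j : ℝ) + 1) * ∫ t in (0 : ℝ)..1, t ^ j * (1 - t * x) ^ α := by
  set c : ℕ → ℝ := fun n => (ascPochhammer ℝ n).eval (-α) / n.factorial with hc
  have hsum : Summable fun n => |c n| * x ^ n := by
    have h := (hasSum_one_sub_rpow α (y := x) (by rwa [abs_of_nonneg hx0])).summable.abs
    simpa [abs_mul, abs_pow, abs_of_nonneg hx0] using h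
  have hmain : HasSum (fun n => ∫ t in (0 : ℝ)..1, t ^ j * (c n * (t * x) ^ n))
      (∫ t in (0 : ℝ)..1, t ^ j * (1 - t * x) ^ α) := by
    refine intervalIntegral.hasSum_integral_of_dominated_convergence
      (fun n _ => |c n| * x ^ n) ?_ ?_ ?_ ?_ ?_
    · intro n
      exact (by fun_prop : Continuous fun t : ℝ => t ^ j * (c n * (t * x) ^ n)).aestronglyMeasurable
    · refine fun n => Filter.Eventually.of_forall fun t ht => ?_
      have ht' := uIoc_zero_one_subset ht
      rw [Real.norm_eq_abs, abs_mul, abs_mul, abs_pow, abs_pow, abs_mul, abs_of_nonneg ht'.1,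
        abs_of_nonneg hx0]
      have h1 : t ^ j ≤ 1 := pow_le_one₀ ht'.1 ht'.2
      have h2 : (t * x) ^ n ≤ x ^ n :=
        pow_le_pow_left₀ (mul_nonneg ht'.1 hx0) (by nlinarith [ht'.2]) n
      calc t ^ j * (|c n| * (t * x) ^ n) ≤ 1 * (|c n| * x ^ n) := by
            gcongr
            exact mul_nonneg (abs_nonneg _) (pow_nonneg (mul_nonneg ht'.1 hx0) n)
        _ = _ := one_mul _
    · exact Filter.Eventually.of_forall fun t _ => hsum
    · exact intervalIntegrable_const
    · refine Filter.Eventually.of_forall fun t ht => ?_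
      have ht' := uIoc_zero_one_subset ht
      refine (hasSum_one_sub_rpow α ?_).mul_left _
      rw [abs_of_nonneg (mul_nonneg ht'.1 hx0)]
      nlinarith [ht'.2]
  rw [← hmain.tsum_eq, ← tsum_mul_left, ordinaryHypergeometric_eq_tsum]
  refine tsum_congr fun n => ?_
  have hint : ∫ t in (0 : ℝ)..1, t ^ j * (c n * (t * x) ^ n) = c n * x ^ n * (1 / (j + n + 1)) := by
    have : ∀ t : ℝ, t ^ j * (c n * (t * x) ^ n) = c n * x ^ n * t ^ (j + n) := fun t => by
      rw [mul_pow, pow_add]; ring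
    simp_rw [this]
    rw [intervalIntegral.integral_const_mul, integral_pow]
    simp
  have hpos : 0 < (ascPochhammer ℝ n).eval ((j : ℝ) + 1 + 1) := ascPochhammer_pos n _ (by positivity)
  have hrat := ascPochhammer_eval_mul_add ((j : ℝ) + 1) n
  have hjn : (0 : ℝ) < j + n + 1 := by positivity
  rw [hint, hc, smul_eq_mul]
  field_simp
  linear_combination (Polynomial.eval (-α) (ascPochhammer ℝ n) * x ^ n) * hrat

/-- Two-sided bounds for the hypergeometric factor, read off from Euler's integral. -/
theorem ordinaryHypergeometric_mem_Icc (α : ℝ) (j : ℕ) {x : ℝ} (hx0 : 0 ≤ x) (hx : x < 1) :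
    ordinaryHypergeometric (-α) ((j : ℝ) + 1) ((j : ℝ) + 1 + 1) x
      ∈ Icc ((1 - x) ^ |α|) ((1 - x) ^ (-|α|)) := by
  rw [ordinaryHypergeometric_eq_integral α j hx0 hx]
  have hI : ∀ C : ℝ, ((j : ℝ) + 1) * ∫ t in (0 : ℝ)..1, t ^ j * C = C := fun C => by
    rw [intervalIntegral.integral_mul_const, integral_pow]
    field_simp
    simp
  have hint : IntervalIntegrable (fun t : ℝ => t ^ j * (1 - t * x) ^ α) volume 0 1 :=
    ((continuousOn_pow j).mul
      (continuousOn_one_sub_mul_rpow α hx0 hx)).intervalIntegrable_of_Icc zero_le_one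
  have hconst : ∀ C : ℝ, IntervalIntegrable (fun t : ℝ => t ^ j * C) volume 0 1 := fun C =>
    (by fun_prop : Continuous fun t : ℝ => t ^ j * C).intervalIntegrable _ _
  have hb : ∀ t ∈ Icc (0 : ℝ) 1, (1 - x) ^ |α| ≤ (1 - t * x) ^ α ∧
      (1 - t * x) ^ α ≤ (1 - x) ^ (-|α|) := fun t ht =>
    rpow_abs_le_rpow (by linarith) (one_sub_mul_mem hx0 ht).1 (one_sub_mul_mem hx0 ht).2
  constructor
  · conv_lhs => rw [← hI ((1 - x) ^ |α|)]
    gcongr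
    refine intervalIntegral.integral_mono_on zero_le_one (hconst _) hint fun t ht => ?_
    exact mul_le_mul_of_nonneg_left (hb t ht).1 (pow_nonneg ht.1 j)
  · conv_rhs => rw [← hI ((1 - x) ^ (-|α|))]
    gcongr
    refine intervalIntegral.integral_mono_on zero_le_one hint (hconst _) fun t ht => ?_
    exact mul_le_mul_of_nonneg_left (hb t ht).2 (pow_nonneg ht.1 j)

theorem basicFunction_natCast (α : ℝ) (n : ℕ) (z : ℂ) : basicFunction α n z = z ^ n := by
  simp [basicFunction]

theorem basicFunction_neg (α : ℝ) (j : ℕ) (z : ℂ) : basicFunction α (-((j : ℤ) + 1)) z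
    = ((ordinaryHypergeometric (-α) ((j : ℝ) + 1) ((j : ℝ) + 1 + 1) (‖z‖ ^ 2) : ℝ) : ℂ)
      * conj z ^ (j + 1) := by
  have h1 : ¬ (0 : ℤ) ≤ -((j : ℤ) + 1) := by omega
  have h2 : (-((j : ℤ) + 1)).natAbs = j + 1 := by omega
  rw [basicFunction, if_neg h1, h2]
  push_cast
  rfl

theorem int_nonneg_or_neg_cases {p : ℤ → Prop} (hn : ∀ n : ℕ, p n) (hneg : ∀ j : ℕ, p (-((j : ℤ) + 1)))
    (k : ℤ) : p k := by
  rcases Int.eq_nat_or_neg k with ⟨n, rfl | rfl⟩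
  · exact hn n
  · cases n with
    | zero => exact hn 0
    | succ j => exact_mod_cast hneg j

theorem norm_sq_lt_one {z : ℂ} (hz : z ∈ Metric.ball (0 : ℂ) 1) : ‖z‖ ^ 2 < 1 := by
  linarith [one_sub_norm_sq_pos hz]

/-- Basic functions are comparable to powers of `|z|`, up to a factor of temperate growth which does
not depend on `k`. -/
theorem norm_basicFunction_mem_Icc (α : ℝ) (k : ℤ) {z : ℂ} (hz : z ∈ Metric.ball (0 : ℂ) 1) :
    ‖basicFunction α k z‖ ∈ Icc (‖z‖ ^ k.natAbs * (1 - ‖z‖ ^ 2) ^ |α|)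
      (‖z‖ ^ k.natAbs * (1 - ‖z‖ ^ 2) ^ (-|α|)) := by
  have hpos := one_sub_norm_sq_pos hz
  induction k using int_nonneg_or_neg_cases with
  | hn n =>
    have h1 := rpow_abs_le_rpow (α := 0) hpos le_rfl (by linarith [sq_nonneg ‖z‖])
    have h2 := rpow_abs_le_rpow (α := α) hpos (le_refl (1 - ‖z‖ ^ 2)) (by linarith [sq_nonneg ‖z‖])
    have h3 : (1 - ‖z‖ ^ 2) ^ |α| ≤ 1 :=
      Real.rpow_le_one hpos.le (by linarith [sq_nonneg ‖z‖]) (abs_nonneg α)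
    have h4 : 1 ≤ (1 - ‖z‖ ^ 2) ^ (-|α|) := by
      rw [Real.rpow_neg hpos.le]; exact (one_le_inv₀ (Real.rpow_pos_of_pos hpos _)).mpr h3
    rw [basicFunction_natCast, norm_pow, Int.natAbs_natCast]
    exact ⟨mul_le_of_le_one_right (by positivity) h3, le_mul_of_one_le_right (by positivity) h4⟩
  | hneg j =>
    have h := ordinaryHypergeometric_mem_Icc α j (sq_nonneg ‖z‖) (norm_sq_lt_one hz)
    have h2 : (-((j : ℤ) + 1)).natAbs = j + 1 := by omega
    have h0 : 0 ≤ ordinaryHypergeometric (-α) ((j : ℝ) + 1) ((j : ℝ) + 1 + 1) (‖z‖ ^ 2) :=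
      (Real.rpow_nonneg hpos.le _).trans h.1
    rw [basicFunction_neg, norm_mul, norm_pow, Complex.norm_conj, Complex.norm_real,
      Real.norm_eq_abs, abs_of_nonneg h0, h2, mul_comm (ordinaryHypergeometric _ _ _ _)]
    exact ⟨mul_le_mul_of_nonneg_left h.1 (by positivity),
      mul_le_mul_of_nonneg_left h.2 (by positivity)⟩

/-- Termwise integration: a power series for `G` gives the expansion of `dbarPrimitive α G`. -/
theorem hasSum_dbarPrimitive (α : ℝ) {G : ℂ → ℂ} {g : ℕ → ℂ}
    (hg : ∀ w ∈ Metric.ball (0 : ℂ) 1, HasSum (fun j => g j * w ^ j) (G w))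
    {z : ℂ} (hz : z ∈ Metric.ball (0 : ℂ) 1) :
    HasSum (fun j : ℕ => g j / (j + 1) * basicFunction α (-((j : ℤ) + 1)) z)
      (dbarPrimitive α G z) := by
  have hpos := one_sub_norm_sq_pos hz
  have hx0 := sq_nonneg ‖z‖
  have hx := norm_sq_lt_one hz
  have hterm : ∀ j : ℕ, g j / (j + 1) * basicFunction α (-((j : ℤ) + 1)) z
      = ∫ t in (0 : ℝ)..1, conj z ^ (j + 1) * g j * ((t ^ j * (1 - t * ‖z‖ ^ 2) ^ α : ℝ) : ℂ) := by
    intro j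
    have hj : (j : ℂ) + 1 ≠ 0 := by exact_mod_cast Nat.succ_ne_zero j
    rw [basicFunction_neg, ordinaryHypergeometric_eq_integral α j hx0 hx,
      intervalIntegral.integral_const_mul, intervalIntegral.integral_ofReal]
    rw [Complex.ofReal_mul]
    push_cast
    rw [div_mul_eq_mul_div, div_eq_iff hj]
    ring
  simp_rw [hterm]
  set M := (1 - ‖z‖ ^ 2) ^ (-|α|) with hM
  have hM0 : 0 ≤ M := Real.rpow_nonneg hpos.le _
  have hsum : Summable fun j : ℕ => ‖z‖ ^ (j + 1) * ‖g j‖ * M := by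
    have h := (hg (conj z) (conj_mem_unitBall.mpr hz)).summable.norm
    refine ((h.mul_left ‖z‖).mul_right M).congr fun j => ?_
    rw [norm_mul, norm_pow, Complex.norm_conj]
    ring
  refine intervalIntegral.hasSum_integral_of_dominated_convergence
    (fun j _ => ‖z‖ ^ (j + 1) * ‖g j‖ * M) ?_ ?_ ?_ ?_ ?_
  · intro j
    refine ContinuousOn.aestronglyMeasurable ?_ measurableSet_uIoc
    refine continuousOn_const.mul (Complex.continuous_ofReal.comp_continuousOn ?_)
    exact ((continuousOn_pow j).mul (continuousOn_one_sub_mul_rpow α hx0 hx)).mono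
      uIoc_zero_one_subset
  · refine fun j => Filter.Eventually.of_forall fun t ht => ?_
    have ht' := uIoc_zero_one_subset ht
    have hw := one_sub_mul_mem hx0 ht'
    have h0 : 0 ≤ (1 - t * ‖z‖ ^ 2) ^ α := Real.rpow_nonneg (by linarith) _
    rw [norm_mul, norm_mul, norm_pow, Complex.norm_conj, Complex.norm_real, Real.norm_eq_abs,
      abs_of_nonneg (mul_nonneg (pow_nonneg ht'.1 j) h0)]
    gcongr
    calc t ^ j * (1 - t * ‖z‖ ^ 2) ^ α ≤ 1 * M := by
          gcongr
          · exact pow_le_one₀ ht'.1 ht'.2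
          · exact (rpow_abs_le_rpow hpos hw.1 hw.2).2
      _ = M := one_mul M
  · exact Filter.Eventually.of_forall fun t _ => hsum
  · exact intervalIntegrable_const
  · refine Filter.Eventually.of_forall fun t ht => ?_
    have ht' := uIoc_zero_one_subset ht
    have hw := one_sub_mul_mem hx0 ht'
    have h := (hg _ (polar_mem_ball (mem_polarDomain hz ht'))).mul_left (conj z)
    have h := h.mul_right (polarWeight z t ^ (α : ℂ))
    refine h.congr_fun ?_
    intro j
    rw [polarWeight_eq, ← Complex.ofReal_cpow (by linarith)]
    push_cast
    ring

/-- The coefficient family of `h + dbarPrimitive α G`, in terms of the power series coefficients of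
`h` and `G`. -/
noncomputable def combinedCoeff (h g : ℕ → ℂ) (k : ℤ) : ℂ :=
  if 0 ≤ k then h k.natAbs else g (k.natAbs - 1) / k.natAbs

theorem combinedCoeff_natCast (h g : ℕ → ℂ) (n : ℕ) : combinedCoeff h g n = h n := by
  simp [combinedCoeff]

theorem combinedCoeff_neg (h g : ℕ → ℂ) (j : ℕ) :
    combinedCoeff h g (-((j : ℤ) + 1)) = g j / (j + 1) := by
  have h1 : ¬ (0 : ℤ) ≤ -((j : ℤ) + 1) := by omega
  have h2 : (-((j : ℤ) + 1)).natAbs = j + 1 := by omega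
  rw [combinedCoeff, if_neg h1, h2]
  simp

theorem hasSum_combinedCoeff (α : ℝ) {u h G : ℂ → ℂ} {a g : ℕ → ℂ}
    (hu : ∀ z ∈ Metric.ball (0 : ℂ) 1, u z = h z + dbarPrimitive α G z)
    (ha : ∀ w ∈ Metric.ball (0 : ℂ) 1, HasSum (fun j => a j * w ^ j) (h w))
    (hg : ∀ w ∈ Metric.ball (0 : ℂ) 1, HasSum (fun j => g j * w ^ j) (G w))
    {z : ℂ} (hz : z ∈ Metric.ball (0 : ℂ) 1) :
    HasSum (fun k : ℤ => combinedCoeff a g k * basicFunction α k z) (u z) := by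
  rw [hu z hz]
  refine HasSum.of_nat_of_neg_add_one ?_ ?_
  · simpa only [combinedCoeff_natCast, basicFunction_natCast] using ha z hz
  · simpa only [combinedCoeff_neg] using hasSum_dbarPrimitive α hg hz

theorem exists_powerSeries {h : ℂ → ℂ} (hh : DifferentiableOn ℂ h (Metric.ball 0 1)) :
    ∃ a : ℕ → ℂ, ∀ w ∈ Metric.ball (0 : ℂ) 1, HasSum (fun j => a j * w ^ j) (h w) := by
  refine ⟨fun j => (j.factorial : ℂ)⁻¹ * iteratedDeriv j h 0, fun w hw => ?_⟩
  refine (Complex.hasSum_taylorSeries_on_ball hh hw).congr_fun fun j => ?_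
  simp only [smul_eq_mul, sub_zero]
  ring

/-- Existence of the series expansion of an α-harmonic function. -/
theorem exists_hasSum_of_isAlphaHarmonic {α : ℝ} {u : ℂ → ℂ} (hu : IsAlphaHarmonic α u) :
    ∃ c : ℤ → ℂ, ∀ z ∈ Metric.ball (0 : ℂ) 1,
      HasSum (fun k : ℤ => c k * basicFunction α k z) (u z) := by
  obtain ⟨h, G, hh, hG, huz⟩ := (isAlphaHarmonic_iff α u).mp hu
  obtain ⟨a, ha⟩ := exists_powerSeries hh
  obtain ⟨g, hg⟩ := exists_powerSeries hG
  exact ⟨combinedCoeff a g, fun z hz => hasSum_combinedCoeff α huz ha hg hz⟩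

theorem differentiableOn_tsum_powerSeries {a : ℕ → ℂ}
    (ha : ∀ r : ℝ, 0 < r → r < 1 → Summable fun j => ‖a j‖ * r ^ j) :
    DifferentiableOn ℂ (fun w => ∑' j, a j * w ^ j) (Metric.ball 0 1) := by
  intro z hz
  obtain ⟨r, hr, hr1⟩ := exists_between (mem_ball_zero_iff.mp hz)
  have h := Complex.differentiableOn_tsum_of_summable_norm (U := Metric.ball (0 : ℂ) r)
    (F := fun j w => a j * w ^ j) (ha r ((norm_nonneg z).trans_lt hr) hr1)
    (fun j => by fun_prop) Metric.isOpen_ball fun j w hw => ?_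
  · exact (h.differentiableAt (Metric.isOpen_ball.mem_nhds
      (mem_ball_zero_iff.mpr hr))).differentiableWithinAt
  · rw [norm_mul, norm_pow]
    gcongr
    exact (mem_ball_zero_iff.mp hw).le

theorem hasSum_powerSeries {a : ℕ → ℂ}
    (ha : ∀ r : ℝ, 0 < r → r < 1 → Summable fun j => ‖a j‖ * r ^ j) {w : ℂ}
    (hw : w ∈ Metric.ball (0 : ℂ) 1) : HasSum (fun j => a j * w ^ j) (∑' j, a j * w ^ j) := by
  obtain ⟨r, hr, hr1⟩ := exists_between (mem_ball_zero_iff.mp hw)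
  refine (Summable.of_norm_bounded (ha r ((norm_nonneg w).trans_lt hr) hr1) fun j => ?_).hasSum
  rw [norm_mul, norm_pow]
  gcongr

/-- A convergent series of basic functions is α-harmonic. -/
theorem isAlphaHarmonic_of_hasSum {α : ℝ} {u : ℂ → ℂ} {c : ℤ → ℂ}
    (hpos : ∀ r : ℝ, 0 < r → r < 1 → Summable fun n : ℕ => ‖c n‖ * r ^ n)
    (hneg : ∀ r : ℝ, 0 < r → r < 1 →
      Summable fun j : ℕ => ‖((j : ℂ) + 1) * c (-((j : ℤ) + 1))‖ * r ^ j)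
    (hu : ∀ z ∈ Metric.ball (0 : ℂ) 1, HasSum (fun k : ℤ => c k * basicFunction α k z) (u z)) :
    IsAlphaHarmonic α u := by
  refine (isAlphaHarmonic_iff α u).mpr ⟨_, _, differentiableOn_tsum_powerSeries hpos,
    differentiableOn_tsum_powerSeries hneg, fun z hz => ?_⟩
  refine (hu z hz).unique ?_
  have h := hasSum_combinedCoeff α (fun _ _ => rfl) (fun w hw => hasSum_powerSeries hpos hw)
    (fun w hw => hasSum_powerSeries hneg hw) hz
  refine h.congr_fun fun k => ?_
  congr 1
  induction k using int_nonneg_or_neg_cases with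
  | hn n => rw [combinedCoeff_natCast]
  | hneg j =>
    have hj : (j : ℂ) + 1 ≠ 0 := by exact_mod_cast Nat.succ_ne_zero j
    rw [combinedCoeff_neg]
    field_simp

/-! ### Fourier coefficients -/

/-- The character `θ ↦ e^{ikθ}`. -/
noncomputable def mode (k : ℤ) (θ : ℝ) : ℂ := (Circle.exp θ : ℂ) ^ k

theorem mode_eq_exp (k : ℤ) (θ : ℝ) : mode k θ = Complex.exp (k * Complex.I * θ) := by
  rw [mode, Circle.coe_exp, ← Complex.exp_int_mul]
  ring_nf

theorem mode_add (k l : ℤ) (θ : ℝ) : mode (k + l) θ = mode k θ * mode l θ :=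
  zpow_add₀ (Circle.exp θ).coe_ne_zero k l

theorem norm_mode (k : ℤ) (θ : ℝ) : ‖mode k θ‖ = 1 := by
  rw [mode, norm_zpow, Circle.norm_coe, one_zpow]

theorem hasDerivAt_mode (k : ℤ) (θ : ℝ) : HasDerivAt (mode k) (k * Complex.I * mode k θ) θ := by
  have h : HasDerivAt (fun t : ℝ => Complex.exp (k * Complex.I * t)) _ θ :=
    ((Complex.ofRealCLM.hasDerivAt (x := θ)).const_mul (k * Complex.I)).cexp
  rw [← funext (mode_eq_exp k)] at h
  refine h.congr_deriv ?_
  simp [mode_eq_exp]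
  ring

theorem contDiff_mode (k : ℤ) (n : ℕ∞ω) : ContDiff ℝ n (mode k) := by
  rw [funext (mode_eq_exp k)]
  exact (contDiff_const.mul Complex.ofRealCLM.contDiff).cexp

theorem continuous_mode (k : ℤ) : Continuous (mode k) := (contDiff_mode k 0).continuous

theorem mode_two_pi (k : ℤ) : mode k (2 * Real.pi) = 1 := by simp [mode]

theorem mode_zero_right (k : ℤ) : mode k 0 = 1 := by simp [mode]

/-- The `k`-th Fourier coefficient of a function of the angle. -/
noncomputable def angleCoeff (ψ : ℝ → ℂ) (k : ℤ) : ℂ :=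
  (2 * Real.pi : ℂ)⁻¹ * ∫ θ in (0 : ℝ)..2 * Real.pi, ψ θ * mode (-k) θ

theorem angleCoeff_mode (m k : ℤ) : angleCoeff (mode m) k = if m = k then 1 else 0 := by
  rw [angleCoeff]
  simp_rw [← mode_add, ← sub_eq_add_neg]
  split_ifs with h
  · subst h
    simp [mode]
    field_simp
  · have h1 : ((m - k : ℤ) : ℂ) * Complex.I ≠ 0 :=
      mul_ne_zero (by exact_mod_cast sub_ne_zero.mpr h) Complex.I_ne_zero
    simp_rw [mode_eq_exp]
    rw [integral_exp_mul_complex h1, ← mode_eq_exp, ← mode_eq_exp, mode_two_pi, mode_zero_right]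
    simp

theorem angleCoeff_const_mul (c : ℂ) (ψ : ℝ → ℂ) (k : ℤ) :
    angleCoeff (fun θ => c * ψ θ) k = c * angleCoeff ψ k := by
  simp_rw [angleCoeff, mul_assoc c, intervalIntegral.integral_const_mul]
  ring

theorem norm_angleCoeff_le {ψ : ℝ → ℂ} {M : ℝ} (hψ : ∀ θ, ‖ψ θ‖ ≤ M) (k : ℤ) :
    ‖angleCoeff ψ k‖ ≤ M := by
  have h := intervalIntegral.norm_integral_le_of_norm_le_const (a := 0) (b := 2 * Real.pi) (C := M)
    (f := fun θ => ψ θ * mode (-k) θ) fun θ _ => by rw [norm_mul, norm_mode, mul_one]; exact hψ θ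
  rw [sub_zero, abs_of_pos Real.two_pi_pos] at h
  rw [angleCoeff, norm_mul, norm_inv]
  have h2 : ‖(2 * Real.pi : ℂ)‖ = 2 * Real.pi := by
    rw [← Complex.ofReal_ofNat, ← Complex.ofReal_mul, Complex.norm_real, Real.norm_eq_abs,
      abs_of_pos Real.two_pi_pos]
  rw [h2, inv_mul_le_iff₀ Real.two_pi_pos]
  linarith

/-- Coefficients of an absolutely convergent trigonometric series are its Fourier coefficients. -/
theorem angleCoeff_of_hasSum {ψ : ℝ → ℂ} {b : ℤ → ℂ} (hb : Summable fun k => ‖b k‖)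
    (hψ : ∀ θ, HasSum (fun k => b k * mode k θ) (ψ θ)) (k : ℤ) : angleCoeff ψ k = b k := by
  have h := intervalIntegral.hasSum_integral_of_dominated_convergence (a := 0) (b := 2 * Real.pi)
    (μ := volume) (F := fun m θ => b m * mode m θ * mode (-k) θ)
    (f := fun θ => ψ θ * mode (-k) θ) (fun m _ => ‖b m‖)
    (fun m => ((continuous_const.mul (continuous_mode m)).mul
      (continuous_mode (-k))).aestronglyMeasurable)
    (fun m => Filter.Eventually.of_forall fun θ _ => by simp [norm_mode])
    (Filter.Eventually.of_forall fun θ _ => hb) intervalIntegrable_const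
    (Filter.Eventually.of_forall fun θ _ => (hψ θ).mul_right _)
  have h2 := h.mul_left (2 * Real.pi : ℂ)⁻¹
  have h3 : ∀ m, (2 * Real.pi : ℂ)⁻¹ * ∫ θ in (0 : ℝ)..2 * Real.pi, b m * mode m θ * mode (-k) θ
      = if m = k then b k else 0 := by
    intro m
    have := angleCoeff_const_mul (b m) (mode m) k
    rw [angleCoeff, angleCoeff_mode] at this
    rw [this]
    split_ifs with h
    · rw [h, mul_one]
    · rw [mul_zero]
  simp_rw [h3] at h2
  exact h2.unique (hasSum_ite_eq k (b k))

/-! ### Coefficient sequences -/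

theorem basicFunction_mul_circle (α : ℝ) (k : ℤ) (z : ℂ) (ζ : Circle) :
    basicFunction α k (z * ζ) = basicFunction α k z * (ζ : ℂ) ^ k := by
  induction k using int_nonneg_or_neg_cases with
  | hn n => rw [basicFunction_natCast, basicFunction_natCast, mul_pow, zpow_natCast]
  | hneg j =>
    have h : (ζ : ℂ) ^ (-((j : ℤ) + 1)) = conj (ζ : ℂ) ^ (j + 1) := by
      rw [← Circle.coe_inv_eq_conj, Circle.coe_inv, inv_pow, zpow_neg]
      norm_cast
    rw [basicFunction_neg, basicFunction_neg, h, map_mul, mul_pow, norm_mul, Circle.norm_coe,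
      mul_one]
    ring

theorem mul_circle_mem_ball {z : ℂ} (hz : z ∈ Metric.ball (0 : ℂ) 1) (ζ : Circle) :
    z * ζ ∈ Metric.ball (0 : ℂ) 1 := by
  rwa [mem_ball_zero_iff, norm_mul, Circle.norm_coe, mul_one, ← mem_ball_zero_iff]

theorem norm_basicFunction_lower (α : ℝ) (k : ℤ) {z : ℂ} (hz : z ∈ Metric.ball (0 : ℂ) 1) :
    ‖z‖ ^ k.natAbs * (1 - ‖z‖ ^ 2) ^ |α| ≤ ‖basicFunction α k z‖ :=
  (norm_basicFunction_mem_Icc α k hz).1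

/-- The coefficients of an expansion are determined by the Fourier coefficients on circles. -/
theorem angleCoeff_eq_of_hasSum {α : ℝ} {u : ℂ → ℂ} {c : ℤ → ℂ}
    (hu : ∀ z ∈ Metric.ball (0 : ℂ) 1, HasSum (fun k : ℤ => c k * basicFunction α k z) (u z))
    {z : ℂ} (hz : z ∈ Metric.ball (0 : ℂ) 1) (k : ℤ) :
    angleCoeff (fun θ => u (z * Circle.exp θ)) k = c k * basicFunction α k z := by
  refine angleCoeff_of_hasSum (hu z hz).summable.norm (fun θ => ?_) k
  refine (hu _ (mul_circle_mem_ball hz (Circle.exp θ))).congr_fun fun m => ?_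
  rw [basicFunction_mul_circle, mode, mul_assoc]

theorem coeff_unique {α : ℝ} {u : ℂ → ℂ} {c d : ℤ → ℂ}
    (hc : ∀ z ∈ Metric.ball (0 : ℂ) 1, HasSum (fun k : ℤ => c k * basicFunction α k z) (u z))
    (hd : ∀ z ∈ Metric.ball (0 : ℂ) 1, HasSum (fun k : ℤ => d k * basicFunction α k z) (u z)) :
    c = d := by
  funext k
  -- any point other than the centre would do
  have hz : ((1 / 2 : ℝ) : ℂ) ∈ Metric.ball (0 : ℂ) 1 := by
    rw [mem_ball_zero_iff, Complex.norm_real]; norm_num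
  have h := (angleCoeff_eq_of_hasSum hc hz k).symm.trans (angleCoeff_eq_of_hasSum hd hz k)
  refine mul_right_cancel₀ ?_ h
  rw [← norm_pos_iff]
  refine lt_of_lt_of_le ?_ (norm_basicFunction_lower α k hz)
  have h1 := one_sub_norm_sq_pos hz
  have h2 : 0 < ‖((1 / 2 : ℝ) : ℂ)‖ := by rw [Complex.norm_real]; norm_num
  positivity

theorem summable_norm_mul_pow {α : ℝ} {u : ℂ → ℂ} {c : ℤ → ℂ}
    (hu : ∀ z ∈ Metric.ball (0 : ℂ) 1, HasSum (fun k : ℤ => c k * basicFunction α k z) (u z))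
    {r : ℝ} (hr0 : 0 ≤ r) (hr : r < 1) : Summable fun k : ℤ => ‖c k‖ * r ^ k.natAbs := by
  have hn : ‖(r : ℂ)‖ = r := by rw [Complex.norm_real, Real.norm_eq_abs, abs_of_nonneg hr0]
  have hz : (r : ℂ) ∈ Metric.ball (0 : ℂ) 1 := by rwa [mem_ball_zero_iff, hn]
  have hp := Real.rpow_pos_of_pos (one_sub_norm_sq_pos hz) |α|
  refine Summable.of_nonneg_of_le (fun k => by positivity) (fun k => ?_)
    ((hu r hz).summable.norm.mul_right ((1 - ‖(r : ℂ)‖ ^ 2) ^ |α|)⁻¹)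
  rw [← div_eq_mul_inv, le_div_iff₀ hp, norm_mul, mul_assoc]
  gcongr
  simpa only [hn] using norm_basicFunction_lower α k hz

/-- The condition on the upper limit in `IsCoefficientSequence` is automatic: convergence at every
radius `r < 1` forces it. -/
theorem isCoefficientSequence_of_hasSum {α : ℝ} {u : ℂ → ℂ} {c : ℤ → ℂ}
    (hu : ∀ z ∈ Metric.ball (0 : ℂ) 1, HasSum (fun k : ℤ => c k * basicFunction α k z) (u z)) :
    IsCoefficientSequence α u c := by
  refine ⟨?_, hu⟩
  -- Since `c k * r ^ |k| → 0`, eventually `|c k| ^ (1 / |k|) ≤ r⁻¹`, for every `r < 1`.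
  have key : ∀ r : ℝ, 0 < r → r < 1 →
      Filter.limsup (fun k : ℤ => ‖c k‖ₑ ^ (1 / (k.natAbs : ℝ))) Filter.cofinite
        ≤ ENNReal.ofReal r⁻¹ := by
    intro r hr0 hr
    refine Filter.limsup_le_of_le (by isBoundedDefault) ?_
    have h1 := (summable_norm_mul_pow hu hr0.le hr).tendsto_cofinite_zero.eventually_le_const
      zero_lt_one
    have h2 : ∀ᶠ k : ℤ in Filter.cofinite, k ≠ 0 := (Set.finite_singleton 0).compl_mem_cofinite
    filter_upwards [h1, h2] with k hk hk0
    have hk1 : (0 : ℝ) < k.natAbs := by exact_mod_cast Int.natAbs_pos.mpr hk0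
    rw [one_div, ENNReal.rpow_inv_le_iff hk1, ENNReal.rpow_natCast,
      ← ENNReal.ofReal_pow (by positivity), ← ofReal_norm]
    refine ENNReal.ofReal_le_ofReal ?_
    rwa [inv_pow, ← one_div, le_div_iff₀ (by positivity)]
  refine ge_of_tendsto (x := 𝓝[<] (1 : ℝ)) (f := fun r => ENNReal.ofReal r⁻¹) ?_ ?_
  · have h1 : Filter.Tendsto (fun r : ℝ => ENNReal.ofReal r⁻¹) (𝓝 1) (𝓝 (ENNReal.ofReal 1⁻¹)) :=
      (ENNReal.continuous_ofReal.tendsto _).comp (tendsto_inv₀ one_ne_zero)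
    simpa using h1.mono_left nhdsWithin_le_nhds
  · filter_upwards [Ioo_mem_nhdsLT (zero_lt_one' ℝ)] with r hr
    exact key r hr.1 hr.2

/-- By uniqueness, the spectrum may be read off from any expansion. -/
theorem mem_spec_iff {α : ℝ} {u : ℂ → ℂ} {c : ℤ → ℂ}
    (hu : ∀ z ∈ Metric.ball (0 : ℂ) 1, HasSum (fun k : ℤ => c k * basicFunction α k z) (u z))
    (k : ℤ) : k ∈ spec α u ↔ c k ≠ 0 := by
  constructor
  · rintro ⟨d, hd, hk⟩
    rwa [coeff_unique hu hd.2]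
  · exact fun h => ⟨c, isCoefficientSequence_of_hasSum hu, h⟩

/-! ### Polynomial growth -/

/-- A family `c` of complex numbers is of polynomial growth: `|c k| ≤ C (|k| + 1)^N`. -/
def PolyGrowth (c : ℤ → ℂ) : Prop :=
  ∃ (C : ℝ) (N : ℕ), ∀ k : ℤ, ‖c k‖ ≤ C * ((k.natAbs : ℝ) + 1) ^ N

theorem PolyGrowth.mul {c d : ℤ → ℂ} (hc : PolyGrowth c) (hd : PolyGrowth d) :
    PolyGrowth fun k => c k * d k := by
  obtain ⟨C, N, h⟩ := hc
  obtain ⟨D, M, h'⟩ := hd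
  refine ⟨C * D, N + M, fun k => ?_⟩
  rw [norm_mul, pow_add]
  calc ‖c k‖ * ‖d k‖ ≤ (C * ((k.natAbs : ℝ) + 1) ^ N) * (D * ((k.natAbs : ℝ) + 1) ^ M) :=
        mul_le_mul (h k) (h' k) (norm_nonneg _) ((norm_nonneg _).trans (h k))
    _ = _ := by ring

theorem polyGrowth_natAbs : PolyGrowth fun k => (k.natAbs : ℂ) :=
  ⟨1, 1, fun k => by rw [Complex.norm_natCast]; linarith⟩

theorem PolyGrowth.comp_neg {c : ℤ → ℂ} (hc : PolyGrowth c) : PolyGrowth fun k => c (-k) := by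
  obtain ⟨C, N, h⟩ := hc
  exact ⟨C, N, fun k => by simpa using h (-k)⟩

theorem add_one_pow_le_choose (n N : ℕ) :
    ((n : ℝ) + 1) ^ N ≤ N.factorial * ((n + N).choose N : ℝ) := by
  have h := Nat.pow_succ_le_ascFactorial (n + 1) N
  rw [Nat.ascFactorial_eq_factorial_mul_choose] at h
  exact_mod_cast h

/-- The bound comes from comparison with the binomial series of `(1 - r)^{-(N+1)}`. -/
theorem summable_and_tsum_pow_mul_geometric_le (N : ℕ) {r : ℝ} (hr0 : 0 ≤ r) (hr : r < 1) :
    Summable (fun n : ℕ => ((n : ℝ) + 1) ^ N * r ^ n) ∧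
      ∑' n : ℕ, ((n : ℝ) + 1) ^ N * r ^ n ≤ N.factorial / (1 - r) ^ (N + 1) := by
  have hn : ‖r‖ < 1 := by rwa [Real.norm_eq_abs, abs_of_nonneg hr0]
  have hs := (summable_choose_mul_geometric_of_norm_lt_one N hn).mul_left (N.factorial : ℝ)
  have hle : ∀ n : ℕ, ((n : ℝ) + 1) ^ N * r ^ n
      ≤ N.factorial * (((n + N).choose N : ℝ) * r ^ n) := fun n => by
    rw [← mul_assoc]
    exact mul_le_mul_of_nonneg_right (add_one_pow_le_choose n N) (by positivity)
  have hs' := Summable.of_nonneg_of_le (fun n => by positivity) hle hs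
  refine ⟨hs', (hs'.tsum_le_tsum hle hs).trans_eq ?_⟩
  rw [tsum_mul_left, tsum_choose_mul_geometric_of_norm_lt_one N hn]
  ring

theorem summable_and_tsum_int_pow_mul_geometric_le (N : ℕ) {r : ℝ} (hr0 : 0 ≤ r) (hr : r < 1) :
    Summable (fun k : ℤ => ((k.natAbs : ℝ) + 1) ^ N * r ^ k.natAbs) ∧
      ∑' k : ℤ, ((k.natAbs : ℝ) + 1) ^ N * r ^ k.natAbs ≤ 2 * (N.factorial / (1 - r) ^ (N + 1)) := by
  obtain ⟨h1, h2⟩ := summable_and_tsum_pow_mul_geometric_le N hr0 hr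
  have hj : ∀ j : ℕ, (-((j : ℤ) + 1)).natAbs = j + 1 := fun j => by omega
  have hs : Summable fun n : ℕ => (((n + 1 : ℕ) : ℝ) + 1) ^ N * r ^ (n + 1) :=
    (summable_nat_add_iff 1 (f := fun n : ℕ => ((n : ℝ) + 1) ^ N * r ^ n)).mpr h1
  have hle : ∑' n : ℕ, (((n + 1 : ℕ) : ℝ) + 1) ^ N * r ^ (n + 1)
      ≤ ∑' n : ℕ, ((n : ℝ) + 1) ^ N * r ^ n := by
    rw [h1.tsum_eq_zero_add]
    simp
  have h := HasSum.of_nat_of_neg_add_one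
    (f := fun k : ℤ => ((k.natAbs : ℝ) + 1) ^ N * r ^ k.natAbs)
    (by simpa using h1.hasSum) (by simpa only [hj] using hs.hasSum)
  exact ⟨h.summable, h.tsum_eq.trans_le (by linarith)⟩

theorem PolyGrowth.summable {c : ℤ → ℂ} (hc : PolyGrowth c) {r : ℝ} (hr0 : 0 ≤ r) (hr : r < 1) :
    Summable fun k : ℤ => ‖c k‖ * r ^ k.natAbs := by
  obtain ⟨C, N, h⟩ := hc
  refine Summable.of_nonneg_of_le (fun k => by positivity) (fun k => ?_)
    ((summable_and_tsum_int_pow_mul_geometric_le N hr0 hr).1.mul_left C)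
  rw [← mul_assoc]
  gcongr
  exact h k

theorem PolyGrowth.summable_basicFunction {c : ℤ → ℂ} (hc : PolyGrowth c) (α : ℝ) {z : ℂ}
    (hz : z ∈ Metric.ball (0 : ℂ) 1) : Summable fun k : ℤ => ‖c k * basicFunction α k z‖ := by
  refine Summable.of_nonneg_of_le (fun k => by positivity) (fun k => ?_)
    ((hc.summable (norm_nonneg z) (mem_ball_zero_iff.mp hz)).mul_right ((1 - ‖z‖ ^ 2) ^ (-|α|)))
  rw [norm_mul, mul_assoc]
  gcongr
  exact (norm_basicFunction_mem_Icc α k hz).2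

/-- A series of basic functions with coefficients of polynomial growth is α-harmonic. -/
theorem PolyGrowth.isAlphaHarmonic {α : ℝ} {u : ℂ → ℂ} {c : ℤ → ℂ} (hc : PolyGrowth c)
    (hu : ∀ z ∈ Metric.ball (0 : ℂ) 1, HasSum (fun k : ℤ => c k * basicFunction α k z) (u z)) :
    IsAlphaHarmonic α u := by
  refine isAlphaHarmonic_of_hasSum (fun r hr0 hr => ?_) (fun r hr0 hr => ?_) hu
  · exact (hc.summable hr0.le hr).comp_injective (i := fun n : ℕ => (n : ℤ)) Nat.cast_injective
  · have h := (polyGrowth_natAbs.mul hc).summable hr0.le hr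
    have h2 := h.comp_injective (i := fun n : ℕ => -((n : ℤ) + 1)) fun a b hab => by
      simpa using hab
    refine (h2.mul_right r⁻¹).congr fun j => ?_
    have hj : (-((j : ℤ) + 1)).natAbs = j + 1 := by omega
    simp only [Function.comp_apply, hj, pow_succ]
    push_cast
    field_simp

theorem PolyGrowth.temperateInDisc {α : ℝ} {u : ℂ → ℂ} {c : ℤ → ℂ} (hc : PolyGrowth c)
    (hu : ∀ z ∈ Metric.ball (0 : ℂ) 1, HasSum (fun k : ℤ => c k * basicFunction α k z) (u z)) :
    TemperateInDisc u := by
  obtain ⟨C, N, h⟩ := id hc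
  have hC : 0 ≤ C := by simpa using (norm_nonneg _).trans (h 0)
  -- `C + 1` in place of `C`, since the constant has to be positive; the powers of `2` come from
  -- `1 - |z|² ≤ 2 (1 - |z|)`
  refine ⟨(C + 1) * (2 * (N.factorial * 2 ^ (N + 1))), |α| + (N + 1), by positivity, by positivity,
    fun z hz => ?_⟩
  have hpos := one_sub_norm_sq_pos hz
  have hz1 := mem_ball_zero_iff.mp hz
  obtain ⟨h1, h2⟩ := summable_and_tsum_int_pow_mul_geometric_le N (norm_nonneg z) hz1
  set M := (1 - ‖z‖ ^ 2) ^ (-|α|) with hM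
  have hM0 : 0 < M := Real.rpow_pos_of_pos hpos _
  have hterm : ∀ k, ‖c k * basicFunction α k z‖
      ≤ C * M * (((k.natAbs : ℝ) + 1) ^ N * ‖z‖ ^ k.natAbs) := fun k => by
    rw [norm_mul]
    calc ‖c k‖ * ‖basicFunction α k z‖
        ≤ (C * ((k.natAbs : ℝ) + 1) ^ N) * (‖z‖ ^ k.natAbs * M) :=
          mul_le_mul (h k) (norm_basicFunction_mem_Icc α k hz).2 (norm_nonneg _)
            ((norm_nonneg _).trans (h k))
      _ = _ := by ring
  have h3 : (1 - ‖z‖ ^ 2) / 2 ≤ 1 - ‖z‖ := by nlinarith [norm_nonneg z]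
  have h4 : (N.factorial : ℝ) / (1 - ‖z‖) ^ (N + 1) ≤
      N.factorial * 2 ^ (N + 1) * ((1 - ‖z‖ ^ 2) ^ (N + 1))⁻¹ := by
    calc (N.factorial : ℝ) / (1 - ‖z‖) ^ (N + 1)
        ≤ N.factorial / ((1 - ‖z‖ ^ 2) / 2) ^ (N + 1) := by gcongr
      _ = _ := by rw [div_pow]; field_simp
  have h5 : (1 - ‖z‖ ^ 2) ^ (-(|α| + (N + 1))) = M * ((1 - ‖z‖ ^ 2) ^ (N + 1))⁻¹ := by
    rw [neg_add, Real.rpow_add hpos, Real.rpow_neg hpos.le ((N : ℝ) + 1), hM]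
    congr 2
    exact_mod_cast Real.rpow_natCast _ (N + 1)
  rw [h5]
  calc ‖u z‖ ≤ ∑' k, ‖c k * basicFunction α k z‖ := by
        rw [← (hu z hz).tsum_eq]
        exact norm_tsum_le_tsum_norm (hc.summable_basicFunction α hz)
    _ ≤ ∑' k : ℤ, C * M * (((k.natAbs : ℝ) + 1) ^ N * ‖z‖ ^ k.natAbs) :=
        (hc.summable_basicFunction α hz).tsum_le_tsum hterm (h1.mul_left _)
    _ ≤ C * M * (2 * (N.factorial * 2 ^ (N + 1) * ((1 - ‖z‖ ^ 2) ^ (N + 1))⁻¹)) := by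
        rw [tsum_mul_left]
        gcongr
        exact h2.trans (by gcongr)
    _ ≤ (C + 1) * M * (2 * (N.factorial * 2 ^ (N + 1) * ((1 - ‖z‖ ^ 2) ^ (N + 1))⁻¹)) := by
        gcongr
        linarith
    _ = _ := by ring

/-- The coefficients of a function of temperate growth are of polynomial growth: evaluate the
Fourier coefficients on the circle of radius `1 - 1 / (2 (|k| + 1))`. -/
theorem polyGrowth_of_temperateInDisc {α : ℝ} {u : ℂ → ℂ} {c : ℤ → ℂ} (ht : TemperateInDisc u)
    (hu : ∀ z ∈ Metric.ball (0 : ℂ) 1, HasSum (fun k : ℤ => c k * basicFunction α k z) (u z)) :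
    PolyGrowth c := by
  obtain ⟨C, N, hC, hN, h⟩ := ht
  -- `N` for the growth of `u`, `|α|` for the lower bound on the hypergeometric factor
  obtain ⟨K, hK⟩ := exists_nat_ge (N + |α|)
  refine ⟨2 * C * 2 ^ K, K, fun k => ?_⟩
  set m : ℝ := (k.natAbs : ℝ) + 1 with hm
  have hm1 : 1 ≤ m := by rw [hm]; linarith [Nat.cast_nonneg (α := ℝ) k.natAbs]
  set s : ℝ := 1 / (2 * m) with hs
  have hs0 : 0 < s := by positivity
  have hs1 : s ≤ 1 / 2 := by rw [hs]; gcongr; linarith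
  have hr : ‖((1 - s : ℝ) : ℂ)‖ = 1 - s := by
    rw [Complex.norm_real, Real.norm_eq_abs, abs_of_pos (by linarith)]
  have hz : ((1 - s : ℝ) : ℂ) ∈ Metric.ball (0 : ℂ) 1 := by
    rw [mem_ball_zero_iff, hr]; linarith
  have hss : s ≤ 1 - (1 - s) ^ 2 := by nlinarith
  have hss1 : 1 - (1 - s) ^ 2 ≤ 1 := by linarith [sq_nonneg (1 - s)]
  have hup : ‖c k * basicFunction α k ((1 - s : ℝ) : ℂ)‖ ≤ C * s ^ (-N) := by
    rw [← angleCoeff_eq_of_hasSum hu hz k]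
    refine norm_angleCoeff_le (fun θ => ?_) k
    refine (h _ (mul_circle_mem_ball hz _)).trans ?_
    rw [norm_mul, Circle.norm_coe, mul_one, hr]
    exact mul_le_mul_of_nonneg_left (Real.rpow_le_rpow_of_nonpos hs0 hss (by linarith)) hC.le
  have hlow : 1 / 2 * s ^ |α| ≤ ‖basicFunction α k ((1 - s : ℝ) : ℂ)‖ := by
    refine le_trans ?_ (norm_basicFunction_lower α k hz)
    rw [hr]
    have h1 : (1 : ℝ) / 2 ≤ (1 - s) ^ k.natAbs := by
      have h2 := one_add_mul_le_pow (a := -s) (by linarith) k.natAbs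
      rw [← sub_eq_add_neg] at h2
      refine le_trans ?_ h2
      have h3 : (k.natAbs : ℝ) * s ≤ m * s := by gcongr; linarith
      have h4 : m * s = 1 / 2 := by rw [hs]; field_simp
      linarith
    have h2 : s ^ |α| ≤ (1 - (1 - s) ^ 2) ^ |α| := Real.rpow_le_rpow hs0.le hss (abs_nonneg α)
    exact mul_le_mul h1 h2 (Real.rpow_nonneg hs0.le _) (by positivity)
  rw [norm_mul] at hup
  have h1 : ‖c k‖ * (1 / 2 * s ^ |α|) ≤ C * s ^ (-N) :=
    (mul_le_mul_of_nonneg_left hlow (norm_nonneg _)).trans hup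
  have hsα : 0 < s ^ |α| := Real.rpow_pos_of_pos hs0 _
  have h2 : ‖c k‖ ≤ 2 * C * s ^ (-(N + |α|)) := by
    rw [neg_add, Real.rpow_add hs0, Real.rpow_neg hs0.le |α|, ← mul_assoc, ← div_eq_mul_inv,
      le_div_iff₀ hsα]
    linarith
  have h3 : s ^ (-(N + |α|)) ≤ (2 * m) ^ K := by
    rw [Real.rpow_neg hs0.le, ← Real.inv_rpow hs0.le, hs, one_div, inv_inv, ← Real.rpow_natCast]
    exact Real.rpow_le_rpow_of_exponent_le (by linarith) hK
  calc ‖c k‖ ≤ 2 * C * (2 * m) ^ K := h2.trans (by gcongr)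
    _ = _ := by rw [mul_pow]; ring

/-! ### The Poisson kernel -/

/-- The binomial coefficient `(α + 1)_m / m!`. -/
noncomputable def risingCoeff (α : ℝ) (m : ℕ) : ℂ :=
  (ascPochhammer ℂ m).eval ((α : ℂ) + 1) / m.factorial

/-- The coefficients of the series expansion of the Poisson kernel: `1` for `k ≥ 0`, and
`(α + 1)_m / m!` for `k = -m < 0`. -/
noncomputable def poissonCoeff (α : ℝ) (k : ℤ) : ℂ :=
  if 0 ≤ k then 1 else risingCoeff α k.natAbs

theorem one_sub_ne_zero_of_mem_ball {z : ℂ} (hz : z ∈ Metric.ball (0 : ℂ) 1) : 1 - z ≠ 0 := by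
  intro h
  rw [← sub_eq_zero.mp h] at hz
  simp at hz

theorem one_sub_mem_slitPlane {w : ℂ} (hw : w ∈ Metric.ball (0 : ℂ) 1) :
    1 - w ∈ Complex.slitPlane := by
  refine Or.inl ?_
  have := (Complex.re_le_norm w).trans_lt (mem_ball_zero_iff.mp hw)
  simpa using this

/-- The Poisson kernel is `1 / (1 - z)` plus a `dbarPrimitive`. The integrand of the latter is the
`t`-derivative of `(1 - t |z|²)^{α+1} / ((1 - z) (1 - t z̄)^{α+1})`, which interpolates between
`1 / (1 - z)` and the Poisson kernel. -/
theorem poissonKernel_eq_add_dbarPrimitive (α : ℝ) {z : ℂ} (hz : z ∈ Metric.ball (0 : ℂ) 1) :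
    poissonKernel α z = 1 / (1 - z)
      + dbarPrimitive α (fun w => ((α : ℂ) + 1) * (1 - w) ^ (-((α : ℂ) + 2))) z := by
  have h1z := one_sub_ne_zero_of_mem_ball hz
  have hG : DifferentiableOn ℂ (fun w : ℂ => ((α : ℂ) + 1) * (1 - w) ^ (-((α : ℂ) + 2)))
      (Metric.ball 0 1) := fun w hw =>
    (((differentiableAt_const _).sub differentiableAt_id).cpow_const
      (one_sub_mem_slitPlane hw)).const_mul _ |>.differentiableWithinAt
  have hder : ∀ t ∈ uIcc (0 : ℝ) 1, HasDerivAt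
      (fun s : ℝ => polarWeight z s ^ ((α : ℂ) + 1) * (1 - s * conj z) ^ (-((α : ℂ) + 1))
        / (1 - z))
      (dbarIntegrand α (fun w => ((α : ℂ) + 1) * (1 - w) ^ (-((α : ℂ) + 2))) (z, t)) t := by
    intro t ht
    rw [uIcc_of_le zero_le_one] at ht
    have hp := mem_polarDomain hz ht
    have hX := polarWeight_mem_slitPlane hp
    have hY := one_sub_mem_slitPlane (polar_mem_ball hp)
    have h0 : HasDerivAt (fun s : ℝ => 1 - (s : ℂ) * conj z) (-(1 * conj z)) t :=
      ((Complex.ofRealCLM.hasDerivAt (x := t)).mul_const (conj z)).const_sub 1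
    have hYd : HasDerivAt (fun s : ℝ => (1 - (s : ℂ) * conj z) ^ (-((α : ℂ) + 1)))
        (-((α : ℂ) + 1) * (1 - t * conj z) ^ (-((α : ℂ) + 1) - 1) * 1 * (-(1 * conj z))) t :=
      ((hasDerivAt_id _).cpow_const (c := -((α : ℂ) + 1)) hY).comp_of_eq t h0 rfl
    refine (((hasDerivAt_polarWeight_cpow ((α : ℂ) + 1) hp).mul hYd).div_const (1 - z)).congr_deriv ?_
    have e1 : polarWeight z t ^ ((α : ℂ) + 1) = polarWeight z t ^ (α : ℂ) * polarWeight z t := by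
      rw [Complex.cpow_add _ _ (Complex.slitPlane_ne_zero hX), Complex.cpow_one]
    have e2 : (1 - t * conj z) ^ (-((α : ℂ) + 1))
        = (1 - t * conj z) ^ (-((α : ℂ) + 2)) * (1 - t * conj z) := by
      rw [show -((α : ℂ) + 1) = -((α : ℂ) + 2) + 1 by ring,
        Complex.cpow_add _ _ (Complex.slitPlane_ne_zero hY), Complex.cpow_one]
    rw [show -((α : ℂ) + 1) - 1 = -((α : ℂ) + 2) by ring, e1, e2, dbarIntegrand,
      show (α : ℂ) + 1 - 1 = α by ring, div_eq_iff h1z, polarWeight]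
    ring
  have hint : IntervalIntegrable (fun t : ℝ =>
      dbarIntegrand α (fun w => ((α : ℂ) + 1) * (1 - w) ^ (-((α : ℂ) + 2))) (z, t)) volume 0 1 :=
    (((contDiffOn_dbarIntegrand α hG 0).continuousOn).comp (f := fun t : ℝ => (z, t))
      (by fun_prop) fun t ht => mem_polarDomain hz ht).intervalIntegrable_of_Icc zero_le_one
  rw [dbarPrimitive, intervalIntegral.integral_eq_sub_of_hasDerivAt hder hint, poissonKernel,
    Complex.ofReal_cpow (one_sub_norm_sq_pos hz).le, Complex.cpow_neg]
  simp [polarWeight_eq]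
  field_simp

theorem hasSum_poissonKernel (α : ℝ) {z : ℂ} (hz : z ∈ Metric.ball (0 : ℂ) 1) :
    HasSum (fun k : ℤ => poissonCoeff α k * basicFunction α k z) (poissonKernel α z) := by
  have h := hasSum_combinedCoeff α (a := fun _ => 1)
    (g := fun j => ((α : ℂ) + 1) * ((ascPochhammer ℂ j).eval ((α : ℂ) + 2) / j.factorial))
    (fun w hw => poissonKernel_eq_add_dbarPrimitive α hw)
    (fun w hw => by simpa using hasSum_geometric_of_norm_lt_one (mem_ball_zero_iff.mp hw))
    (fun w hw => by
      simpa only [mul_assoc] using (hasSum_one_sub_cpow_neg ((α : ℂ) + 2)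
        (mem_ball_zero_iff.mp hw)).mul_left ((α : ℂ) + 1)) hz
  refine h.congr_fun fun k => ?_
  congr 1
  induction k using int_nonneg_or_neg_cases with
  | hn n => simp [combinedCoeff_natCast, poissonCoeff]
  | hneg j =>
    have h1 : ¬ (0 : ℤ) ≤ -((j : ℤ) + 1) := by omega
    have h2 : (-((j : ℤ) + 1)).natAbs = j + 1 := by omega
    rw [combinedCoeff_neg, poissonCoeff, if_neg h1, h2, risingCoeff, ascPochhammer_succ_left,
      Nat.factorial_succ]
    simp only [Polynomial.eval_mul, Polynomial.eval_X, Polynomial.eval_comp, Polynomial.eval_add,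
      Polynomial.eval_one]
    rw [show (α : ℂ) + 1 + 1 = α + 2 by ring]
    push_cast
    have hf : (j.factorial : ℂ) ≠ 0 := by exact_mod_cast j.factorial_ne_zero
    have hj : (j : ℂ) + 1 ≠ 0 := by exact_mod_cast Nat.succ_ne_zero j
    field_simp

theorem norm_risingCoeff_succ (α : ℝ) (m : ℕ) :
    ‖risingCoeff α (m + 1)‖ * (m + 1) = ‖risingCoeff α m‖ * |α + 1 + m| := by
  have h : risingCoeff α (m + 1) * ((m : ℂ) + 1) = risingCoeff α m * ((α + 1 + m : ℝ) : ℂ) := by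
    have hf : (m.factorial : ℂ) ≠ 0 := by exact_mod_cast m.factorial_ne_zero
    have hj : (m : ℂ) + 1 ≠ 0 := by exact_mod_cast Nat.succ_ne_zero m
    rw [risingCoeff, risingCoeff, ascPochhammer_succ_eval, Nat.factorial_succ]
    push_cast
    field_simp
  have h' := congrArg norm h
  rw [norm_mul, norm_mul, Complex.norm_real, Real.norm_eq_abs] at h'
  rw [← h']
  congr 1
  exact_mod_cast (Complex.norm_natCast (m + 1)).symm

theorem choose_succ_mul (m M : ℕ) :
    (((m + 1 + M).choose M : ℕ) : ℝ) * (m + 1) = ((m + M).choose M : ℕ) * (m + M + 1) := by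
  have h := Nat.choose_mul_succ_eq (m + M) M
  rw [show m + M + 1 - M = m + 1 by omega, show m + M + 1 = m + 1 + M by omega] at h
  have h' : (((m + M).choose M : ℕ) : ℝ) * ((m + 1 + M : ℕ) : ℝ)
      = ((m + 1 + M).choose M : ℕ) * ((m + 1 : ℕ) : ℝ) := by exact_mod_cast h
  push_cast at h'
  linarith

theorem choose_le_pow_add_one (m M : ℕ) :
    (((m + M).choose M : ℕ) : ℝ) ≤ ((M : ℝ) + 1) ^ M * ((m : ℝ) + 1) ^ M := by
  have h : (((m + M).choose M : ℕ) : ℝ) ≤ ((m + M : ℕ) : ℝ) ^ M := by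
    exact_mod_cast Nat.choose_le_pow (m + M) M
  refine h.trans ?_
  rw [← mul_pow]
  gcongr
  push_cast
  nlinarith [mul_nonneg (Nat.cast_nonneg (α := ℝ) M) (Nat.cast_nonneg (α := ℝ) m)]

/-- Upper bound for the binomial coefficients, by comparison of successive quotients. -/
theorem norm_risingCoeff_le {α : ℝ} {M : ℕ} (hM : |α| ≤ M) (m : ℕ) :
    ‖risingCoeff α m‖ ≤ (m + M).choose M := by
  induction m with
  | zero => simp [risingCoeff]
  | succ m ih =>
    have hm : (0 : ℝ) < m + 1 := by positivity
    refine le_of_mul_le_mul_right ?_ hm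
    rw [norm_risingCoeff_succ, choose_succ_mul]
    refine mul_le_mul ih ?_ (abs_nonneg _) (by positivity)
    refine (abs_add_le _ _).trans ?_
    rw [abs_of_nonneg (a := (m : ℝ)) (Nat.cast_nonneg m)]
    linarith [abs_add_le α 1, abs_one (α := ℝ)]

/-- Lower bound for the binomial coefficients, by comparison of successive quotients. -/
theorem norm_risingCoeff_ge {α : ℝ} {M : ℕ} (hM : |α| ≤ M) (i : ℕ) :
    ‖risingCoeff α M‖ ≤ ‖risingCoeff α (i + M)‖ * (i + M).choose M := by
  induction i with
  | zero => simp
  | succ i ih =>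
    refine ih.trans ?_
    have hm : (0 : ℝ) < i + 1 := by positivity
    have hs := norm_risingCoeff_succ α (i + M)
    have hc := choose_succ_mul i M
    rw [show i + 1 + M = i + M + 1 by omega] at hc ⊢
    push_cast at hs
    have hge : (i : ℝ) + 1 ≤ |α + 1 + (i + M)| :=
      le_trans (by linarith [neg_abs_le α]) (le_abs_self _)
    have hiM : (0 : ℝ) < i + M + 1 := by positivity
    refine le_of_mul_le_mul_right ?_ (mul_pos hm hiM)
    calc ‖risingCoeff α (i + M)‖ * ((i + M).choose M : ℕ) * ((i + 1) * (i + M + 1))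
        ≤ ‖risingCoeff α (i + M)‖ * ((i + M).choose M : ℕ) * (|α + 1 + (i + M)| * (i + M + 1)) := by
          gcongr
      _ = (‖risingCoeff α (i + M)‖ * |α + 1 + (i + M)|)
            * (((i + M).choose M : ℕ) * (i + M + 1)) := by ring
      _ = _ := by rw [← hs, ← hc]; ring

theorem polyGrowth_poissonCoeff (α : ℝ) : PolyGrowth (poissonCoeff α) := by
  obtain ⟨M, hM⟩ := exists_nat_ge |α|
  refine ⟨((M : ℝ) + 1) ^ M, M, fun k => ?_⟩
  rw [poissonCoeff]
  split_ifs
  · rw [norm_one, ← mul_pow]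
    refine one_le_pow₀ ?_
    nlinarith [Nat.cast_nonneg (α := ℝ) M, Nat.cast_nonneg (α := ℝ) k.natAbs]
  · exact (norm_risingCoeff_le hM _).trans (choose_le_pow_add_one _ _)

/-- The inverses of the nonzero coefficients of the Poisson kernel are of polynomial growth. (The
inverse of a vanishing coefficient is `0` here.) -/
theorem polyGrowth_inv_poissonCoeff (α : ℝ) : PolyGrowth fun k => (poissonCoeff α k)⁻¹ := by
  obtain ⟨M, hM⟩ := exists_nat_ge |α|
  set S : ℝ := 1 + ∑ j ∈ Finset.range (M + 1), ‖risingCoeff α j‖⁻¹ with hS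
  have hsum : 0 ≤ ∑ j ∈ Finset.range (M + 1), ‖risingCoeff α j‖⁻¹ :=
    Finset.sum_nonneg fun j _ => by positivity
  have hS1 : 1 ≤ S := by linarith
  have hSj : ∀ j ≤ M, ‖risingCoeff α j‖⁻¹ ≤ S := fun j hj => by
    have := Finset.single_le_sum (f := fun j => ‖risingCoeff α j‖⁻¹) (fun j _ => by positivity)
      (Finset.mem_range_succ_iff.mpr hj)
    linarith
  refine ⟨S, M, fun k => ?_⟩
  have hone : ∀ m : ℕ, 1 ≤ ((m : ℝ) + 1) ^ M := fun m =>
    one_le_pow₀ (by linarith [Nat.cast_nonneg (α := ℝ) m])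
  have hS0 : (0 : ℝ) ≤ S := zero_le_one.trans hS1
  simp only [poissonCoeff, norm_inv]
  split_ifs
  · rw [norm_one, inv_one]
    exact one_le_mul_of_one_le_of_one_le hS1 (hone _)
  · rcases le_total k.natAbs M with hk | hk
    · exact (hSj _ hk).trans (le_mul_of_one_le_right hS0 (hone _))
    · obtain ⟨i, hi⟩ := Nat.exists_eq_add_of_le' hk
      rw [hi]
      by_cases h0 : risingCoeff α (i + M) = 0
      · rw [h0, norm_zero, inv_zero]; positivity
      have hpos : 0 < ‖risingCoeff α (i + M)‖ := norm_pos_iff.mpr h0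
      have hM0 : 0 < ‖risingCoeff α M‖ := by
        -- once a rising factorial vanishes, all later ones do
        have hdvd : risingCoeff α M = 0 → ∀ l, ‖risingCoeff α (l + M)‖ = 0 := by
          intro h l
          induction l with
          | zero => simpa using h
          | succ l ih =>
            have hs := norm_risingCoeff_succ α (l + M)
            rw [ih, zero_mul] at hs
            rw [show l + 1 + M = l + M + 1 by omega]
            exact (mul_eq_zero.mp hs).resolve_right (by positivity)
        exact norm_pos_iff.mpr fun h => hpos.ne' (hdvd h i)
      have hge := norm_risingCoeff_ge hM i
      have hch : (((i + M).choose M : ℕ) : ℝ) ≤ (((i + M : ℕ) : ℝ) + 1) ^ M := by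
        have h : (((i + M).choose M : ℕ) : ℝ) ≤ ((i + M : ℕ) : ℝ) ^ M := by
          exact_mod_cast Nat.choose_le_pow (i + M) M
        exact h.trans (by gcongr; linarith)
      have h3 : ‖risingCoeff α (i + M)‖⁻¹ ≤ ‖risingCoeff α M‖⁻¹ * ((i + M).choose M : ℕ) := by
        rw [inv_le_iff_one_le_mul₀ hpos, mul_assoc, ← div_eq_inv_mul, one_le_div hM0, mul_comm]
        exact hge
      exact h3.trans (mul_le_mul (hSj M le_rfl) hch (by positivity) hS0)

/-- If `α` is not a negative integer, no coefficient of the Poisson kernel vanishes. -/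
theorem poissonCoeff_ne_zero {α : ℝ} (hα : ∀ n : ℕ, 0 < n → α ≠ -(n : ℝ)) (k : ℤ) :
    poissonCoeff α k ≠ 0 := by
  rw [poissonCoeff]
  split_ifs
  · exact one_ne_zero
  · generalize k.natAbs = m
    induction m with
    | zero => simp [risingCoeff]
    | succ m ih =>
      intro h
      have hs := norm_risingCoeff_succ α m
      rw [h, norm_zero, zero_mul, eq_comm, mul_eq_zero, norm_eq_zero, abs_eq_zero] at hs
      refine hα (m + 1) m.succ_pos ?_
      push_cast
      linarith [hs.resolve_left ih]

/-! ### Distributions and trigonometric series -/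

/-- The character `ζ ↦ ζ^k` as a test function. -/
noncomputable def modeTest (k : ℤ) : TestFunction :=
  ⟨fun ζ => (ζ : ℂ) ^ k, (contDiff_mode k ∞ : ContDiff ℝ ∞ (mode k))⟩

theorem angle_modeTest (k : ℤ) : (modeTest k).angle = mode k := rfl

/-- Evaluation of a test function at an angle. -/
noncomputable def angleEval (θ : ℝ) : TestFunction →ₗ[ℂ] ℂ where
  toFun φ := φ.angle θ
  map_add' _ _ := rfl
  map_smul' _ _ := rfl

theorem norm_int_mul_I_pow (k : ℤ) (j : ℕ) : ‖((k : ℂ) * Complex.I) ^ j‖ = (k.natAbs : ℝ) ^ j := by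
  rw [norm_pow, norm_mul, Complex.norm_I, mul_one, Complex.norm_intCast, Nat.cast_natAbs,
    Int.cast_abs]

/-- Termwise differentiation of a trigonometric series with rapidly decreasing coefficients. -/
theorem iteratedDeriv_of_hasSum_mode {b : ℤ → ℂ} {ψ : ℝ → ℂ}
    (hb : ∀ j : ℕ, Summable fun k => ‖b k‖ * (k.natAbs : ℝ) ^ j)
    (hψ : ∀ θ, HasSum (fun k => b k * mode k θ) (ψ θ)) (j : ℕ) :
    iteratedDeriv j ψ = fun θ => ∑' k : ℤ, b k * ((k : ℂ) * Complex.I) ^ j * mode k θ := by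
  have hnorm : ∀ (j : ℕ) (k : ℤ) (θ : ℝ),
      ‖b k * ((k : ℂ) * Complex.I) ^ j * mode k θ‖ = ‖b k‖ * (k.natAbs : ℝ) ^ j := fun j k θ => by
    rw [norm_mul, norm_mode, mul_one, norm_mul, norm_int_mul_I_pow]
  induction j with
  | zero =>
    funext θ
    simp only [iteratedDeriv_zero, pow_zero, mul_one]
    exact (hψ θ).tsum_eq.symm
  | succ j ih =>
    rw [iteratedDeriv_succ, ih]
    funext θ
    refine (hasDerivAt_tsum (g' := fun k θ => b k * ((k : ℂ) * Complex.I) ^ (j + 1) * mode k θ)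
      (hb (j + 1)) (fun k y => ?_) (fun k y => (hnorm (j + 1) k y).le) (y₀ := 0) ?_ θ).deriv
    · refine ((hasDerivAt_mode k y).const_mul (b k * ((k : ℂ) * Complex.I) ^ j)).congr_deriv ?_
      ring
    · exact Summable.of_norm ((hb j).congr fun k => (hnorm j k 0).symm)

theorem supSeminorm_le_of_hasSum {b : ℤ → ℂ} {φ : TestFunction}
    (hb : ∀ j : ℕ, Summable fun k => ‖b k‖ * (k.natAbs : ℝ) ^ j)
    (hφ : ∀ θ, HasSum (fun k => b k * mode k θ) (φ.angle θ)) (j : ℕ) :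
    TestFunction.supSeminorm j φ ≤ ∑' k, ‖b k‖ * (k.natAbs : ℝ) ^ j := by
  refine ciSup_le fun θ => ?_
  rw [iteratedDeriv_of_hasSum_mode hb hφ j]
  refine tsum_of_norm_bounded (hb j).hasSum fun k => ?_
  rw [norm_mul, norm_mode, mul_one, norm_mul, norm_int_mul_I_pow]

/-- A trigonometric series with rapidly decreasing coefficients converges in `C^∞(𝕋)`. -/
theorem hasSum_modeTest {b : ℤ → ℂ} {φ : TestFunction}
    (hb : ∀ j : ℕ, Summable fun k => ‖b k‖ * (k.natAbs : ℝ) ^ j)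
    (hφ : ∀ θ, HasSum (fun k => b k * mode k θ) (φ.angle θ)) :
    HasSum (fun k => b k • modeTest k) φ := by
  rw [HasSum, SummationFilter.unconditional_filter, TestFunction.withSeminorms.tendsto_nhds]
  intro j ε hε
  have htail := (tendsto_tsum_compl_atTop_zero
    fun k : ℤ => ‖b k‖ * (k.natAbs : ℝ) ^ j).eventually_lt_const hε
  filter_upwards [htail] with s hs
  -- the difference has the coefficients `-b k` for `k ∉ s`
  rw [map_sub_rev]
  refine lt_of_le_of_lt (supSeminorm_le_of_hasSum (b := ((s : Set ℤ)ᶜ).indicator b) ?_ ?_ j) ?_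
  · intro i
    refine Summable.of_nonneg_of_le (fun k => by positivity) (fun k => ?_) (hb i)
    gcongr
    exact norm_indicator_le_norm_self b k
  · intro θ
    have h1 : (φ - ∑ k ∈ s, b k • modeTest k).angle θ
        = φ.angle θ - ∑ k ∈ s, b k * mode k θ := by
      change angleEval θ (φ - ∑ k ∈ s, b k • modeTest k) = _
      rw [map_sub, map_sum]
      rfl
    rw [h1]
    have h2 : HasSum (fun k => (s : Set ℤ).indicator b k * mode k θ) (∑ k ∈ s, b k * mode k θ) := by
      have h3 := hasSum_sum_of_ne_finset_zero (s := s) (L := .unconditional ℤ)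
        (f := fun k => (s : Set ℤ).indicator b k * mode k θ) fun k hk => by
          rw [indicator_of_notMem (by exact_mod_cast hk), zero_mul]
      rwa [Finset.sum_congr rfl fun k hk => by
        rw [indicator_of_mem (by exact_mod_cast hk)]] at h3
    refine ((hφ θ).sub h2).congr_fun fun k => ?_
    rw [indicator_compl]
    simp only [Pi.sub_apply]
    ring
  · refine lt_of_eq_of_lt ?_ hs
    refine Eq.trans ?_ (tsum_subtype ((s : Set ℤ)ᶜ) fun k => ‖b k‖ * (k.natAbs : ℝ) ^ j).symm
    refine tsum_congr fun k => ?_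
    by_cases hk : k ∈ (s : Set ℤ)ᶜ
    · rw [indicator_of_mem hk, indicator_of_mem hk]
    · rw [indicator_of_notMem hk, indicator_of_notMem hk, norm_zero, zero_mul]

theorem natAbs_pow_le (k : ℤ) {j N : ℕ} (h : j ≤ N) :
    (k.natAbs : ℝ) ^ j ≤ ((k.natAbs : ℝ) + 1) ^ N :=
  (pow_le_pow_left₀ (by positivity) (by linarith) j).trans
    (pow_le_pow_right₀ (by linarith [Nat.cast_nonneg (α := ℝ) k.natAbs]) h)

theorem supSeminorm_modeTest_le (j : ℕ) (k : ℤ) :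
    TestFunction.supSeminorm j (modeTest k) ≤ (k.natAbs : ℝ) ^ j := by
  have h0 : ∀ i : ℕ, Function.support (fun l => ‖(Pi.single k 1 : ℤ → ℂ) l‖ * (l.natAbs : ℝ) ^ i)
      ⊆ ({k} : Finset ℤ) := fun i l hl => by
    by_contra h
    simp [Pi.single_eq_of_ne (show l ≠ k by simpa using h)] at hl
  have h := supSeminorm_le_of_hasSum (b := Pi.single k 1) (φ := modeTest k)
    (fun i => summable_of_hasFiniteSupport ((Finset.finite_toSet _).subset (h0 i))) (fun θ => ?_) j
  · rw [tsum_eq_single k] at h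
    · simpa using h
    · intro l hl
      simp [Pi.single_eq_of_ne hl]
  · have := hasSum_single (f := fun l => (Pi.single k 1 : ℤ → ℂ) l * mode l θ) k fun l hl => by
      simp [Pi.single_eq_of_ne hl]
    simpa [angle_modeTest] using this

/-- The Fourier coefficients of a distribution are of polynomial growth. -/
theorem polyGrowth_apply_modeTest (f : CircleDistribution) : PolyGrowth fun k => f (modeTest k) := by
  obtain ⟨s, C, -, hC⟩ := Seminorm.bound_of_continuous TestFunction.withSeminorms
    ((normSeminorm ℂ ℂ).comp (f : TestFunction →ₗ[ℂ] ℂ)) (continuous_norm.comp f.continuous)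
  refine ⟨C, s.sup id, fun k => ?_⟩
  refine (hC (modeTest k)).trans ?_
  rw [smul_apply, NNReal.smul_def, smul_eq_mul]
  gcongr
  exact Seminorm.finset_sup_apply_le (by positivity) fun j hj =>
    (supSeminorm_modeTest_le j k).trans (natAbs_pow_le k (Finset.le_sup (f := id) hj))

theorem angleCoeff_deriv {ψ : ℝ → ℂ} (hψ : ContDiff ℝ 1 ψ) (hper : ψ (2 * Real.pi) = ψ 0) (k : ℤ) :
    angleCoeff (deriv ψ) k = k * Complex.I * angleCoeff ψ k := by
  have h := intervalIntegral.integral_mul_deriv_eq_deriv_mul (a := 0) (b := 2 * Real.pi)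
    (u := mode (-k)) (v := ψ) (fun x _ => hasDerivAt_mode (-k) x)
    (fun x _ => ((hψ.differentiable (by simp)).differentiableAt).hasDerivAt)
    ((continuous_const.mul (continuous_mode (-k))).intervalIntegrable _ _)
    ((hψ.continuous_deriv le_rfl).intervalIntegrable _ _)
  rw [mode_two_pi, mode_zero_right, hper, sub_self, zero_sub] at h
  simp_rw [angleCoeff, mul_comm (deriv ψ _), mul_comm (ψ _), h, mul_assoc,
    intervalIntegral.integral_const_mul]
  push_cast
  ring

theorem angleCoeff_iteratedDeriv (φ : TestFunction) (j : ℕ) (k : ℤ) :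
    angleCoeff (iteratedDeriv j φ.angle) k = (k * Complex.I) ^ j * angleCoeff φ.angle k := by
  induction j with
  | zero => simp
  | succ j ih =>
    rw [iteratedDeriv_succ, angleCoeff_deriv, ih, pow_succ]
    · ring
    · rw [iteratedDeriv_eq_iterate]
      exact_mod_cast (φ.contDiff_angle.of_le (by exact_mod_cast le_top)).iterate_deriv' 1 j
    · have h := congrFun (iteratedDeriv_comp_add_const j φ.angle (2 * Real.pi)) 0
      rw [show (fun t => φ.angle (t + 2 * Real.pi)) = φ.angle from funext φ.periodic_angle] at h
      simpa using h.symm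

theorem norm_angleCoeff_mul_pow_le (φ : TestFunction) (j : ℕ) (k : ℤ) :
    ‖angleCoeff φ.angle k‖ * (k.natAbs : ℝ) ^ j ≤ TestFunction.supSeminorm j φ := by
  rw [← norm_int_mul_I_pow, ← norm_mul, mul_comm, ← angleCoeff_iteratedDeriv]
  exact norm_angleCoeff_le (fun θ => le_ciSup (φ.bddAbove j) θ) k

theorem norm_angleCoeff_mul_add_one_pow_le (φ : TestFunction) (n : ℕ) (k : ℤ) :
    ‖angleCoeff φ.angle k‖ * ((k.natAbs : ℝ) + 1) ^ n
      ≤ 2 ^ n * (TestFunction.supSeminorm 0 φ + TestFunction.supSeminorm n φ) := by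
  have h0 := norm_angleCoeff_mul_pow_le φ 0 k
  have hn := norm_angleCoeff_mul_pow_le φ n k
  have h : ((k.natAbs : ℝ) + 1) ^ n ≤ 2 ^ n * ((k.natAbs : ℝ) ^ 0 + (k.natAbs : ℝ) ^ n) := by
    rcases Nat.eq_zero_or_pos k.natAbs with h | h
    · rw [h, Nat.cast_zero, zero_add, one_pow, pow_zero]
      have : (1 : ℝ) ≤ 2 ^ n := one_le_pow₀ (by norm_num)
      nlinarith [pow_nonneg (le_refl (0 : ℝ)) n]
    · have h1 : (1 : ℝ) ≤ k.natAbs := by exact_mod_cast h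
      calc ((k.natAbs : ℝ) + 1) ^ n ≤ (2 * k.natAbs) ^ n := by gcongr; linarith
        _ = 2 ^ n * (k.natAbs : ℝ) ^ n := mul_pow _ _ _
        _ ≤ _ := by gcongr; simp
  calc ‖angleCoeff φ.angle k‖ * ((k.natAbs : ℝ) + 1) ^ n
      ≤ ‖angleCoeff φ.angle k‖ * (2 ^ n * ((k.natAbs : ℝ) ^ 0 + (k.natAbs : ℝ) ^ n)) := by gcongr
    _ = 2 ^ n * (‖angleCoeff φ.angle k‖ * (k.natAbs : ℝ) ^ 0
          + ‖angleCoeff φ.angle k‖ * (k.natAbs : ℝ) ^ n) := by ring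
    _ ≤ _ := by gcongr

theorem summable_inv_natAbs_add_one_sq :
    Summable fun k : ℤ => (((k.natAbs : ℝ) + 1) ^ 2)⁻¹ := by
  have h : Summable fun n : ℕ => (((n : ℝ) + 1) ^ 2)⁻¹ := by
    have := (summable_nat_add_iff 1).mpr (Real.summable_nat_pow_inv.mpr (by norm_num : 1 < 2))
    simpa using this
  refine Summable.of_nat_of_neg_add_one (by simpa using h) ?_
  have h2 := (summable_nat_add_iff 1).mpr h
  refine h2.congr fun n => ?_
  rw [show (-((n : ℤ) + 1)).natAbs = n + 1 by omega]

/-- Every family of polynomial growth is the family of Fourier coefficients of a distribution. -/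
theorem exists_distribution {d : ℤ → ℂ} (hd : PolyGrowth d) :
    ∃ f : CircleDistribution, ∀ k, f (modeTest k) = d k := by
  obtain ⟨C, N, h⟩ := hd
  have hC : 0 ≤ C := by simpa using (norm_nonneg _).trans (h 0)
  -- two derivatives more than the growth of `d` make the series converge absolutely
  set B : TestFunction → ℝ := fun φ =>
    C * (2 ^ (N + 2) * (TestFunction.supSeminorm 0 φ + TestFunction.supSeminorm (N + 2) φ)) with hB
  have hbound : ∀ (φ : TestFunction) (k : ℤ),
      ‖d k * angleCoeff φ.angle k‖ ≤ B φ * (((k.natAbs : ℝ) + 1) ^ 2)⁻¹ := by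
    intro φ k
    rw [norm_mul, ← div_eq_mul_inv, le_div_iff₀ (by positivity)]
    calc ‖d k‖ * ‖angleCoeff φ.angle k‖ * ((k.natAbs : ℝ) + 1) ^ 2
        ≤ C * ((k.natAbs : ℝ) + 1) ^ N * ‖angleCoeff φ.angle k‖ * ((k.natAbs : ℝ) + 1) ^ 2 := by
          gcongr
          exact h k
      _ = C * (‖angleCoeff φ.angle k‖ * ((k.natAbs : ℝ) + 1) ^ (N + 2)) := by ring
      _ ≤ B φ := mul_le_mul_of_nonneg_left (norm_angleCoeff_mul_add_one_pow_le φ (N + 2) k) hC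
  have hsum : ∀ φ : TestFunction, Summable fun k => d k * angleCoeff φ.angle k := fun φ =>
    Summable.of_norm_bounded (summable_inv_natAbs_add_one_sq.mul_left (B φ)) (hbound φ)
  set S : ℝ := ∑' k : ℤ, (((k.natAbs : ℝ) + 1) ^ 2)⁻¹ with hS
  have hS0 : 0 ≤ S := tsum_nonneg fun k => by positivity
  let F : TestFunction →ₗ[ℂ] ℂ :=
    { toFun := fun φ => ∑' k, d k * angleCoeff φ.angle k
      map_add' := fun φ ψ => by
        rw [← (hsum φ).tsum_add (hsum ψ)]
        refine tsum_congr fun k => ?_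
        rw [← mul_add]
        congr 1
        have hi : ∀ χ : TestFunction, IntervalIntegrable (fun θ => χ.angle θ * mode (-k) θ) volume 0
            (2 * Real.pi) := fun χ =>
          (χ.contDiff_angle.continuous.mul (continuous_mode _)).intervalIntegrable _ _
        rw [angleCoeff, angleCoeff, angleCoeff, ← mul_add,
          ← intervalIntegral.integral_add (hi φ) (hi ψ)]
        simp_rw [TestFunction.angle_add, Pi.add_apply, add_mul]
      map_smul' := fun c φ => by
        rw [RingHom.id_apply, smul_eq_mul, ← tsum_mul_left]
        refine tsum_congr fun k => ?_
        have := angleCoeff_const_mul c φ.angle k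
        rw [TestFunction.angle_smul]
        change d k * angleCoeff (fun θ => c * φ.angle θ) k = _
        rw [this]
        ring }
  have hF : Continuous F := by
    obtain ⟨K, hK⟩ : ∃ K : NNReal, (K : ℝ) = C * 2 ^ (N + 2) * 2 * S :=
      ⟨⟨C * 2 ^ (N + 2) * 2 * S, by positivity⟩, rfl⟩
    refine TestFunction.withSeminorms.continuous_normedSpace_rng ℂ F ⟨{0, N + 2}, K, fun φ => ?_⟩
    have h1 : ‖F φ‖ ≤ B φ * S := by
      rw [hS, ← tsum_mul_left]
      exact tsum_of_norm_bounded (summable_inv_natAbs_add_one_sq.mul_left (B φ)).hasSum (hbound φ)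
    have h2 : ∀ i ∈ ({0, N + 2} : Finset ℕ), TestFunction.supSeminorm i φ
        ≤ (({0, N + 2} : Finset ℕ).sup TestFunction.supSeminorm) φ := fun i hi =>
      Seminorm.le_def.mp (Finset.le_sup (f := TestFunction.supSeminorm) hi) φ
    refine h1.trans ?_
    rw [smul_apply, NNReal.smul_def, smul_eq_mul, hK, hB]
    have h3 := h2 0 (by simp)
    have h4 := h2 (N + 2) (by simp)
    set Q : ℝ := (({0, N + 2} : Finset ℕ).sup TestFunction.supSeminorm) φ
    calc C * (2 ^ (N + 2) * (TestFunction.supSeminorm 0 φ + TestFunction.supSeminorm (N + 2) φ)) * S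
        ≤ C * (2 ^ (N + 2) * (Q + Q)) * S := by gcongr
      _ = _ := by ring
  refine ⟨⟨F, hF⟩, fun k => ?_⟩
  change ∑' m, d m * angleCoeff (modeTest k).angle m = d k
  rw [tsum_eq_single k, angle_modeTest, angleCoeff_mode, if_pos rfl, mul_one]
  intro m hm
  rw [angle_modeTest, angleCoeff_mode, if_neg hm.symm, mul_zero]

/-! ### Poisson integrals -/

theorem polyGrowth_natAbs_pow (j : ℕ) : PolyGrowth fun k => (k.natAbs : ℂ) ^ j :=
  ⟨1, j, fun k => by
    rw [norm_pow, Complex.norm_natCast, one_mul]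
    exact natAbs_pow_le k le_rfl⟩

/-- The series expansion of a Poisson integral. -/
theorem hasSum_poissonIntegral (α : ℝ) (f : CircleDistribution) (z : Metric.ball (0 : ℂ) 1) :
    HasSum (fun k : ℤ => poissonCoeff α k * f (modeTest (-k)) * basicFunction α k z)
      (poissonIntegral α f z) := by
  have hz := z.2
  have hsum : ∀ j : ℕ, Summable fun k : ℤ =>
      ‖poissonCoeff α (-k) * basicFunction α (-k) z‖ * (k.natAbs : ℝ) ^ j := by
    intro j
    have h := ((polyGrowth_poissonCoeff α).mul (polyGrowth_natAbs_pow j)).summable_basicFunction α hz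
    refine ((Equiv.neg ℤ).summable_iff.mpr h).congr fun k => ?_
    simp only [Function.comp_apply, Equiv.neg_apply, Int.natAbs_neg, norm_mul, norm_pow,
      Complex.norm_natCast]
    ring
  have hang : ∀ θ : ℝ, HasSum (fun k : ℤ => poissonCoeff α (-k) * basicFunction α (-k) z * mode k θ)
      ((poissonTestFunction α z).angle θ) := by
    intro θ
    have h := hasSum_poissonKernel α (mul_circle_mem_ball hz (Circle.exp θ)⁻¹)
    have h' := (Equiv.neg ℤ).hasSum_iff.mpr h
    have hval : (poissonTestFunction α z).angle θ
        = poissonKernel α (z * ((Circle.exp θ)⁻¹ : Circle)) := by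
      rw [Circle.coe_inv_eq_conj]
      rfl
    rw [hval]
    refine h'.congr_fun fun k => ?_
    simp only [Function.comp_apply, Equiv.neg_apply]
    rw [basicFunction_mul_circle, Circle.coe_inv, inv_zpow', neg_neg, mode, mul_assoc]
  have h := (hasSum_modeTest hsum hang).mapL f
  have h' := (Equiv.neg ℤ).hasSum_iff.mpr h
  refine h'.congr_fun fun k => ?_
  simp only [Function.comp_apply, Equiv.neg_apply, neg_neg, map_smul, smul_eq_mul]
  ring

/-- The characterization of Poisson integrals of distributions, for every real `α`. -/
theorem exists_eq_poissonIntegral_iff (α : ℝ) (u : ℂ → ℂ) :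
    (∃ f : CircleDistribution, ∀ z : Metric.ball (0 : ℂ) 1, u z = poissonIntegral α f z) ↔
      IsAlphaHarmonic α u ∧ TemperateInDisc u ∧ spec α u ⊆ spec α (poissonKernel α) := by
  constructor
  · rintro ⟨f, hf⟩
    have hu : ∀ z ∈ Metric.ball (0 : ℂ) 1, HasSum
        (fun k : ℤ => poissonCoeff α k * f (modeTest (-k)) * basicFunction α k z) (u z) :=
      fun z hz => hf ⟨z, hz⟩ ▸ hasSum_poissonIntegral α f ⟨z, hz⟩
    have hc := (polyGrowth_poissonCoeff α).mul (polyGrowth_apply_modeTest f).comp_neg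
    refine ⟨hc.isAlphaHarmonic hu, hc.temperateInDisc hu, fun k hk => ?_⟩
    rw [mem_spec_iff hu] at hk
    exact (mem_spec_iff (fun z hz => hasSum_poissonKernel α hz) k).mpr (left_ne_zero_of_mul hk)
  · rintro ⟨hharm, htemp, hspec⟩
    obtain ⟨c, hc⟩ := exists_hasSum_of_isAlphaHarmonic hharm
    obtain ⟨f, hf⟩ := exists_distribution ((polyGrowth_of_temperateInDisc htemp hc).mul
      (polyGrowth_inv_poissonCoeff α)).comp_neg
    refine ⟨f, fun z => (hc z z.2).unique ?_⟩
    refine (hasSum_poissonIntegral α f z).congr_fun fun k => ?_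
    rw [hf, neg_neg]
    congr 1
    by_cases h0 : poissonCoeff α k = 0
    · -- the spectral condition forces `c k = 0` here
      have : c k = 0 := by
        by_contra hck
        exact (mem_spec_iff (fun z hz => hasSum_poissonKernel α hz) k).mp
          (hspec ((mem_spec_iff hc k).mpr hck)) h0
      rw [this, h0, zero_mul]
    · field_simp

theorem spec_subset_spec_poissonKernel {α : ℝ} (hα : ∀ n : ℕ, 0 < n → α ≠ -(n : ℝ)) (u : ℂ → ℂ) :
    spec α u ⊆ spec α (poissonKernel α) := fun k _ =>
  (mem_spec_iff (fun _ hz => hasSum_poissonKernel α hz) k).mpr (poissonCoeff_ne_zero hα k)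

end AlphaHarmonic

theorem mainTheorem11 (α : ℝ) (u : ℂ → ℂ) :
    ((∃ f : AlphaHarmonic.CircleDistribution,
        ∀ z : Metric.ball (0 : ℂ) 1, u z = AlphaHarmonic.poissonIntegral α f z) ↔
      (AlphaHarmonic.IsAlphaHarmonic α u ∧ AlphaHarmonic.TemperateInDisc u ∧
        AlphaHarmonic.spec α u ⊆ AlphaHarmonic.spec α (AlphaHarmonic.poissonKernel α))) ∧
    ((∀ n : ℕ, 0 < n → α ≠ -(n : ℝ)) →
      (AlphaHarmonic.IsAlphaHarmonic α u →
        AlphaHarmonic.spec α u ⊆ AlphaHarmonic.spec α (AlphaHarmonic.poissonKernel α)) ∧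
      ((∃ f : AlphaHarmonic.CircleDistribution,
          ∀ z : Metric.ball (0 : ℂ) 1, u z = AlphaHarmonic.poissonIntegral α f z) ↔
        (AlphaHarmonic.IsAlphaHarmonic α u ∧ AlphaHarmonic.TemperateInDisc u))) := by
  refine ⟨AlphaHarmonic.exists_eq_poissonIntegral_iff α u, fun hα => ?_⟩
  have hspec := AlphaHarmonic.spec_subset_spec_poissonKernel hα u
  refine ⟨fun _ => hspec, (AlphaHarmonic.exists_eq_poissonIntegral_iff α u).trans ?_⟩
  exact ⟨fun h => ⟨h.1, h.2.1⟩, fun h => ⟨h.1, h.2, hspec⟩⟩
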